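/- Let $\mathfrak F$ be a real finite-dimensional normed division algebra, i.e. $\mathbb R,\mathbb C,\mathbb H$ (quaternions) or $\mathbb O$ (octonions), and let $\beta=\dim_{\mathbb R}\mathfrak F\in\{1,2,4,8\}$. For a matrix $A$ over $\mathfrak F$ let $A^H$ be its conjugate transpose, let $\operatorname{tr}$ be the real part of the trace, and let $\mathfrak P_m^\beta$ be the cone of positive definite Hermitian $m\times m$ matrices over $\mathfrak F$, i.e. $A=A^H$ and $\operatorname{Re}\,v^H(Av)>0$ for all $v\neq0$. For $A\in\mathfrak P_m^\beta$ the determinant $|A|>0$ is the number whose $\beta$-th power is the determinant of the $\mathbb R$-linear map $v\mapsto Av$ on $\mathfrak F^m$ (the usual determinant over $\mathbb R$ and $\mathbb C$, the Moore determinant over $\mathbb H$, and $ab-\|x\|^2$ for $A=\begin{pmatrix}a&x\\ \bar x&b\end{pmatrix}$ over any $\mathfrak F$). Let $(dX)$ be Lebesgue measure on rectangular matrices (the product over all entries and all $\beta$ real coordinates of each entry), let $(dA)=\prod_i da_{ii}\prod_{i<j}(da_{ij})$ be Lebesgue measure on Hermitian matrices, and let $$\Gamma_m^\beta[a]=\int_{\mathfrak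 P_m^\beta}e^{-\operatorname{tr}A}\,|A|^{a-(m-1)\beta/2-1}\,(dA).$$ Let $k\ge0$, $m\ge1$, $n_0,\dots,n_k\ge m$ and $n=n_0+\dots+n_k$. Let $h:[0,\infty)\to[0,\infty)$ be Borel measurable with $\int_0^\infty u^{mn\beta/2-1}h(\beta u)\,du<\infty$, and let $X$ be a random $n\times m$ matrix over $\mathfrak F$ with the elliptical distribution $\mathcal E^\beta_{n\times m}(0,I_n,I_m;h)$, i.e. with density $h(\beta\operatorname{tr}Y^HY)$ with respect to $(dY)$. Partition $X=(X_0^H,X_1^H,\dots,X_k^H)^H$, with $X_i$ of size $n_i\times m$. (i) The joint distribution of $V=\operatorname{tr}X_0^HX_0$ and $X_1,\dots,X_k$ has, with respect to $(dv)(dX_1)\cdots(dX_k)$ on $v>0$, the density $$\frac{\pi^{n_0m\beta/2}}{\Gamma_1^\beta[n_0m\beta/2]}\;h\Big[\beta\Big(v+\operatorname{tr}\sum_{i=1}^kX_i^HX_i\Big)\Big]\,v^{n_0m\beta/2-1}$$ (the multimatrix variate generalised Gamma–Elliptical distribution). (ii) Suppose moreover that $m\le2$ if $\mathfrak F=\mathbb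 O$ (there is no restriction on $m$ for $\mathbb R,\mathbb C,\mathbb H$). The joint distribution of $\mathbf V=X_0^HX_0$ and $X_1,\dots,X_k$ has, with respect to $(d\mathbf V)(dX_1)\cdots(dX_k)$ on $\mathbf V\in\mathfrak P_m^\beta$, the density $$\frac{\pi^{\beta n_0m/2}\,|\mathbf V|^{\beta(n_0-m+1)/2-1}}{\Gamma_m^\beta[\beta n_0/2]}\;h\Big[\beta\operatorname{tr}\Big(\mathbf V+\sum_{i=1}^kX_i^HX_i\Big)\Big]$$ (the multimatricvariate generalised Wishart–Elliptical distribution). -/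

import Mathlib

open MeasureTheory
open scoped Matrix

noncomputable section

/-- `𝔽` is a real normed division algebra (finite dimensionality is the separate class
`FiniteDimensional ℝ 𝔽`): a Euclidean space with a bilinear, not necessarily associative,
multiplication, a nonzero unit and `‖a b‖ = ‖a‖ ‖b‖`; `star` is its usual conjugation, the reflection
fixing the real line `ℝ 1` and changing the sign of its orthogonal complement. -/
class NormedDivisionAlg (𝔽 : Type*) [NormedAddCommGroup 𝔽] [InnerProductSpace ℝ 𝔽]
    [Mul 𝔽] [One 𝔽] [Star 𝔽] : Prop where
  add_mul' : ∀ a b c : 𝔽, (a + b) * c = a * c + b * c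
  mul_add' : ∀ a b c : 𝔽, a * (b + c) = a * b + a * c
  smul_mul' : ∀ (r : ℝ) (a b : 𝔽), (r • a) * b = r • (a * b)
  mul_smul' : ∀ (r : ℝ) (a b : 𝔽), a * (r • b) = r • (a * b)
  one_mul' : ∀ a : 𝔽, 1 * a = a
  mul_one' : ∀ a : 𝔽, a * 1 = a
  one_ne_zero' : (1 : 𝔽) ≠ 0
  norm_mul' : ∀ a b : 𝔽, ‖a * b‖ = ‖a‖ * ‖b‖
  star_eq' : ∀ a : 𝔽, star a = (2 * inner ℝ (1 : 𝔽) a) • (1 : 𝔽) - a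

namespace NormedDivisionAlg

/-! ### The four examples -/

instance instReal : NormedDivisionAlg ℝ where
  add_mul' := add_mul
  mul_add' := mul_add
  smul_mul' := smul_mul_assoc
  mul_smul' r a b := mul_smul_comm r a b
  one_mul' := one_mul
  mul_one' := mul_one
  one_ne_zero' := one_ne_zero
  norm_mul' := norm_mul
  star_eq' a := by simp; ring

instance instComplex : NormedDivisionAlg ℂ where
  add_mul' := add_mul
  mul_add' := mul_add
  smul_mul' := smul_mul_assoc
  mul_smul' r a b := mul_smul_comm r a b
  one_mul' := one_mul
  mul_one' := mul_one
  one_ne_zero' := one_ne_zero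
  norm_mul' := norm_mul
  star_eq' a := by
    apply Complex.ext <;> simp [Complex.inner]
    ring

instance instQuaternion : NormedDivisionAlg (Quaternion ℝ) where
  add_mul' := add_mul
  mul_add' := mul_add
  smul_mul' := smul_mul_assoc
  mul_smul' r a b := mul_smul_comm r a b
  one_mul' := one_mul
  mul_one' := mul_one
  one_ne_zero' := one_ne_zero
  norm_mul' := norm_mul
  star_eq' a := by
    have h1 : (1 : Quaternion ℝ).re = 1 := rfl
    have h2 : (1 : Quaternion ℝ).imI = 0 := rfl
    have h3 : (1 : Quaternion ℝ).imJ = 0 := rfl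
    have h4 : (1 : Quaternion ℝ).imK = 0 := rfl
    ext <;> simp [Quaternion.inner_def, h1, h2, h3, h4]
    ring

end NormedDivisionAlg

/-- The octonions, by the Cayley–Dickson construction: pairs of quaternions with the Euclidean norm
and the product `(a, b) (c, d) = (a c - d̄ b, d a + b c̄)`. -/
def Octonion : Type := WithLp 2 (Quaternion ℝ × Quaternion ℝ)

namespace Octonion

instance : NormedAddCommGroup Octonion :=
  inferInstanceAs (NormedAddCommGroup (WithLp 2 (Quaternion ℝ × Quaternion ℝ)))
instance : InnerProductSpace ℝ Octonion :=
  inferInstanceAs (InnerProductSpace ℝ (WithLp 2 (Quaternion ℝ × Quaternion ℝ)))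
instance : FiniteDimensional ℝ Octonion :=
  inferInstanceAs (FiniteDimensional ℝ (WithLp 2 (Quaternion ℝ × Quaternion ℝ)))

/-- The octonion with Cayley–Dickson components `a` and `b`. -/
def mk (a b : Quaternion ℝ) : Octonion := WithLp.toLp 2 (a, b)
/-- First Cayley–Dickson component. -/
def fst (x : Octonion) : Quaternion ℝ := (WithLp.ofLp x).1
/-- Second Cayley–Dickson component. -/
def snd (x : Octonion) : Quaternion ℝ := (WithLp.ofLp x).2

instance : Mul Octonion :=
  ⟨fun x y => mk (x.fst * y.fst - star y.snd * x.snd) (y.snd * x.fst + x.snd * star y.fst)⟩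
instance : One Octonion := ⟨mk 1 0⟩
instance : Star Octonion := ⟨fun x => mk (star x.fst) (-x.snd)⟩

@[ext] theorem ext {x y : Octonion} (h₁ : x.fst = y.fst) (h₂ : x.snd = y.snd) : x = y := by
  have h : WithLp.ofLp x = WithLp.ofLp y := Prod.ext h₁ h₂
  exact WithLp.ofLp_injective 2 h

@[simp] theorem fst_mul (x y : Octonion) :
    (x * y).fst = x.fst * y.fst - star y.snd * x.snd := rfl
@[simp] theorem snd_mul (x y : Octonion) :
    (x * y).snd = y.snd * x.fst + x.snd * star y.fst := rfl
@[simp] theorem fst_one : (1 : Octonion).fst = 1 := rfl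
@[simp] theorem snd_one : (1 : Octonion).snd = 0 := rfl
@[simp] theorem fst_star (x : Octonion) : (star x).fst = star x.fst := rfl
@[simp] theorem snd_star (x : Octonion) : (star x).snd = -x.snd := rfl
@[simp] theorem fst_add (x y : Octonion) : (x + y).fst = x.fst + y.fst := rfl
@[simp] theorem snd_add (x y : Octonion) : (x + y).snd = x.snd + y.snd := rfl
@[simp] theorem fst_sub (x y : Octonion) : (x - y).fst = x.fst - y.fst := rfl
@[simp] theorem snd_sub (x y : Octonion) : (x - y).snd = x.snd - y.snd := rfl
@[simp] theorem fst_smul (r : ℝ) (x : Octonion) : (r • x).fst = r • x.fst := rfl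
@[simp] theorem snd_smul (r : ℝ) (x : Octonion) : (r • x).snd = r • x.snd := rfl
@[simp] theorem fst_zero : (0 : Octonion).fst = 0 := rfl

theorem inner_eq (x y : Octonion) :
    inner ℝ x y = inner ℝ x.fst y.fst + inner ℝ x.snd y.snd := rfl

theorem norm_sq_eq (x : Octonion) :
    ‖x‖ ^ 2 = Quaternion.normSq x.fst + Quaternion.normSq x.snd := by
  rw [← real_inner_self_eq_norm_sq, inner_eq, Quaternion.inner_self, Quaternion.inner_self]

instance : NormedDivisionAlg Octonion where
  add_mul' a b c := by ext1 <;> simp [add_mul, mul_add] <;> abel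
  mul_add' a b c := by ext1 <;> simp [add_mul, mul_add] <;> abel
  smul_mul' r a b := by ext1 <;> simp [smul_sub]
  mul_smul' r a b := by ext1 <;> simp [smul_sub]
  one_mul' a := by ext1 <;> simp
  mul_one' a := by ext1 <;> simp
  one_ne_zero' h := by simpa using congrArg fst h
  norm_mul' a b := by
    rw [← sq_eq_sq₀ (norm_nonneg _) (by positivity), mul_pow, norm_sq_eq, norm_sq_eq, norm_sq_eq]
    simp [Quaternion.normSq_def']
    ring
  star_eq' a := by
    have h : inner ℝ (1 : Octonion) a = a.fst.re := by simp [inner_eq, Quaternion.inner_def]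
    have h1 : (1 : Quaternion ℝ).re = 1 := rfl
    have h2 : (1 : Quaternion ℝ).imI = 0 := rfl
    have h3 : (1 : Quaternion ℝ).imJ = 0 := rfl
    have h4 : (1 : Quaternion ℝ).imK = 0 := rfl
    rw [h]
    ext <;> simp [h1, h2, h3, h4]
    ring

end Octonion

namespace NormedDivisionAlg

/-- Matrices carry the product `σ`-algebra of their entries. -/
instance instMeasurableSpaceMatrix {ι κ α : Type*} [MeasurableSpace α] :
    MeasurableSpace (Matrix ι κ α) :=
  inferInstanceAs (MeasurableSpace (ι → κ → α))

variable (𝔽 : Type*) [NormedAddCommGroup 𝔽] [InnerProductSpace ℝ 𝔽] [FiniteDimensional ℝ 𝔽]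
  [Mul 𝔽] [One 𝔽] [Star 𝔽] [NormedDivisionAlg 𝔽]

/-- `β`, the real dimension of `𝔽`. -/
def beta : ℝ := (Module.finrank ℝ 𝔽 : ℝ)

variable {𝔽}

/-- The real part of `a : 𝔽`, that is, its coordinate along the unit. -/
def re (a : 𝔽) : ℝ := inner ℝ (1 : 𝔽) a

/-- The trace of a square matrix, as a real number (for a Hermitian matrix the trace is real). -/
def retr {ι : Type*} [Fintype ι] (A : Matrix ι ι 𝔽) : ℝ := re A.trace

/-- The `ℝ`-linear map `v ↦ A v` on columns. -/
def mulVecLin {m : ℕ} (A : Matrix (Fin m) (Fin m) 𝔽) : (Fin m → 𝔽) →ₗ[ℝ] (Fin m → 𝔽) where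
  toFun v i := ∑ j, A i j * v j
  map_add' v w := by
    funext i
    simp [mul_add', Finset.sum_add_distrib]
  map_smul' r v := by
    funext i
    simp [mul_smul', Finset.smul_sum]

/-- The cone of positive definite Hermitian matrices: `A = Aᴴ` and `vᴴ (A v) > 0` for `v ≠ 0`. -/
def posDefCone (𝔽 : Type*) [NormedAddCommGroup 𝔽] [InnerProductSpace ℝ 𝔽]
    [Mul 𝔽] [One 𝔽] [Star 𝔽] [NormedDivisionAlg 𝔽] (m : ℕ) : Set (Matrix (Fin m) (Fin m) 𝔽) :=
  {A | A.IsHermitian ∧ ∀ v : Fin m → 𝔽, v ≠ 0 → 0 < re (∑ i, star (v i) * mulVecLin A v i)}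

/-- The determinant `|A|` of a positive definite Hermitian matrix, uniformly in `𝔽`: the real
determinant of `v ↦ A v` is `|A| ^ β`. On positive definite matrices this is the usual determinant
over `ℝ` and `ℂ`, the Moore determinant over the quaternions, and `a b - ‖x‖²` for
`A = !![a, x; star x, b]` over any `𝔽`. -/
def hdet {m : ℕ} (A : Matrix (Fin m) (Fin m) 𝔽) : ℝ :=
  (LinearMap.det (mulVecLin A)) ^ (1 / beta 𝔽)

section measures

variable (𝔽) [MeasurableSpace 𝔽] [BorelSpace 𝔽]

/-- Lebesgue measure `(dX)` on the `ι × κ` matrices: the product over all entries of the Lebesgue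
measure of `𝔽` (in orthonormal coordinates). -/
def matVolume (ι κ : Type*) [Fintype ι] [Fintype κ] : Measure (Matrix ι κ 𝔽) :=
  (Measure.pi fun _ : ι => Measure.pi fun _ : κ => (volume : Measure 𝔽) : Measure (ι → κ → 𝔽))

/-- The Hermitian matrix with given (real) diagonal and given entries above the diagonal. -/
def hermOf {m : ℕ} (p : (Fin m → ℝ) × ({q : Fin m × Fin m // q.1 < q.2} → 𝔽)) :
    Matrix (Fin m) (Fin m) 𝔽 :=
  Matrix.of fun i j =>
    if hij : i < j then p.2 ⟨(i, j), hij⟩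
    else if hji : j < i then star (p.2 ⟨(j, i), hji⟩)
    else p.1 i • (1 : 𝔽)

/-- Lebesgue measure `(dS) = ∏ ds_ii ∏_{i < j} ds_ij` on the Hermitian matrices, viewed as a measure
on all square matrices that is concentrated on the Hermitian ones. -/
def hermVolume (m : ℕ) : Measure (Matrix (Fin m) (Fin m) 𝔽) :=
  Measure.map (hermOf 𝔽)
    ((Measure.pi fun _ : Fin m => (volume : Measure ℝ)).prod
      (Measure.pi fun _ : {q : Fin m × Fin m // q.1 < q.2} => (volume : Measure 𝔽)))

/-- The multivariate Gamma function
`Γ_m^β[a] = ∫_{A > 0} etr(-A) |A| ^ (a - (m - 1) β / 2 - 1) (dA)`. -/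
def multiGamma (m : ℕ) (a : ℝ) : ℝ :=
  ∫ A in posDefCone 𝔽 m,
    Real.exp (-retr A) * hdet A ^ (a - ((m : ℝ) - 1) * beta 𝔽 / 2 - 1) ∂(hermVolume 𝔽 m)

end measures

/-- The random element `Y` has density `f` with respect to the reference measure `μ`. -/
structure HasDensity {Ω E : Type*} [MeasurableSpace Ω] [MeasurableSpace E] (P : Measure Ω)
    (Y : Ω → E) (μ : Measure E) (f : E → ℝ) : Prop where
  aemeasurable : AEMeasurable Y P
  aemeasurable_density : AEMeasurable f μ
  nonneg : 0 ≤ᵐ[μ] f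
  map_eq : P.map Y = μ.withDensity fun y => ENNReal.ofReal (f y)

/-- `Y ~ E^β(0, I, I; h)`: the random `ι × Fin m` matrix `Y` has the matrix variate elliptical
distribution with location `0`, identity scale matrices and density generator `h`. -/
structure IsSphericalElliptical {Ω ι : Type*} [MeasurableSpace Ω] [Fintype ι] {m : ℕ}
    [MeasurableSpace 𝔽] [BorelSpace 𝔽]
    (P : Measure Ω) (Y : Ω → Matrix ι (Fin m) 𝔽) (h : ℝ → ℝ) : Prop where
  measurable_gen : Measurable h
  gen_nonneg : ∀ u, 0 ≤ u → 0 ≤ h u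
  integrable_gen : IntegrableOn
    (fun u : ℝ => u ^ ((m : ℝ) * (Fintype.card ι : ℝ) * beta 𝔽 / 2 - 1) * h (beta 𝔽 * u))
    (Set.Ioi 0)
  hasDensity : HasDensity P Y (matVolume 𝔽 ι (Fin m)) fun y => h (beta 𝔽 * retr (yᴴ * y))

/-- The `i`-th block of rows of a matrix whose rows are indexed by `Σ i, Fin (n i)`, that is, of
`X = (X₀ᴴ, …, X_kᴴ)ᴴ` with `X_i` of size `n i × m`. -/
def block {k m : ℕ} {n : Fin (k + 1) → ℕ} (X : Matrix (Σ i, Fin (n i)) (Fin m) 𝔽)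
    (i : Fin (k + 1)) : Matrix (Fin (n i)) (Fin m) 𝔽 :=
  Matrix.of fun r c => X ⟨i, r⟩ c

end NormedDivisionAlg

end

/-! The density of X depends on X₀ only through T(X₀), where T(Y) is tr YᴴY or YᴴY, and Lebesgue
measure splits over the blocks. So if T carries (dX₀) to ρ ν, the joint law of T(X₀) and the other
blocks has density ρ h (`hasDensity_of_map_block`). What remains is to find the two images of
Lebesgue measure.

For the trace, T is the squared Euclidean norm in real dimension n₀mβ, and polar coordinates give a
constant times s^(n₀mβ/2 - 1) ds (`exists_lintegral_norm_sq`).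

For the Gram matrix, induct on the number m + 1 of columns, which range over a real space E of
dimension Nβ (`exists_gramFormula`). Fix the first column x ≠ 0 and write the others as x c_j/‖x‖ +
z_j with xᴴz_j = 0, an isometric splitting of E. The Gram matrix then has corner r = ‖x‖², first row
v = ‖x‖c, and as Schur complement the Gram matrix W of the z_j. On the cone, (r, v, W) are
coordinates with dA = dr dv dW and |A| = r|W|. Polar coordinates contribute r^(Nβ/2 - 1), and
passing from c to v contributes r^(-βm/2). Together they give r^(β(N-m)/2 - 1), the same power that
|W| carries by induction, since N and the number of columns both drop by one.

No constant is tracked through the induction. Testing the final formulas on exp(-tr) gives a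
Gaussian integral, a power of π, on one side and the Gamma integral on the other.

Associativity is replaced where possible by ā(ac) = ‖a‖²c, a consequence of the multiplicative norm.
With at most two columns the Schur complement is at most 1 × 1, and this identity suffices. -/

noncomputable section

set_option linter.unusedSectionVars false

namespace NormedDivisionAlg

open scoped RealInnerProductSpace

/-! ### Conjugation and alternativity from the multiplicative norm -/

section Algebra

variable {𝔽 : Type*} [NormedAddCommGroup 𝔽] [InnerProductSpace ℝ 𝔽]
  [Mul 𝔽] [One 𝔽] [Star 𝔽] [NormedDivisionAlg 𝔽]

/-- Multiplication as a bilinear map. -/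
def mulBilin (𝔽 : Type*) [NormedAddCommGroup 𝔽] [InnerProductSpace ℝ 𝔽]
    [Mul 𝔽] [One 𝔽] [Star 𝔽] [NormedDivisionAlg 𝔽] : 𝔽 →ₗ[ℝ] 𝔽 →ₗ[ℝ] 𝔽 :=
  LinearMap.mk₂ ℝ (fun a b : 𝔽 => a * b) add_mul' smul_mul' mul_add' mul_smul'

@[simp] theorem mulBilin_apply (a b : 𝔽) : mulBilin 𝔽 a b = a * b := rfl

theorem mul_zero' (a : 𝔽) : a * 0 = 0 := (mulBilin 𝔽 a).map_zero

theorem zero_mul' (a : 𝔽) : 0 * a = 0 := (mulBilin 𝔽).map_zero₂ a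

theorem mul_sum' {ι : Type*} (s : Finset ι) (a : 𝔽) (f : ι → 𝔽) :
    a * ∑ i ∈ s, f i = ∑ i ∈ s, a * f i := map_sum (mulBilin 𝔽 a) f s

theorem sum_mul' {ι : Type*} (s : Finset ι) (a : 𝔽) (f : ι → 𝔽) :
    (∑ i ∈ s, f i) * a = ∑ i ∈ s, f i * a := (mulBilin 𝔽).map_sum₂ s f a

theorem mul_sub' (a b c : 𝔽) : a * (b - c) = a * b - a * c := (mulBilin 𝔽 a).map_sub b c

theorem sub_mul' (a b c : 𝔽) : (a - b) * c = a * c - b * c := (mulBilin 𝔽).map_sub₂ a b c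

theorem norm_one' : ‖(1 : 𝔽)‖ = 1 := by
  have h := norm_mul' (1 : 𝔽) 1
  rw [one_mul'] at h
  have h0 : ‖(1 : 𝔽)‖ ≠ 0 := norm_ne_zero_iff.2 one_ne_zero'
  exact mul_left_cancel₀ h0 (by rw [← h, mul_one])

/-- Conjugation as a linear map. -/
def starLin (𝔽 : Type*) [NormedAddCommGroup 𝔽] [InnerProductSpace ℝ 𝔽]
    [Mul 𝔽] [One 𝔽] [Star 𝔽] [NormedDivisionAlg 𝔽] : 𝔽 →ₗ[ℝ] 𝔽 where
  toFun := star
  map_add' a b := by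
    simp only [star_eq' (𝔽 := 𝔽), inner_add_right, mul_add, add_smul]; abel
  map_smul' r a := by
    simp only [star_eq' (𝔽 := 𝔽), inner_smul_right, smul_sub, smul_smul, RingHom.id_apply]
    congr 2; ring

@[simp] theorem starLin_apply (a : 𝔽) : starLin 𝔽 a = star a := rfl

theorem star_add' (a b : 𝔽) : star (a + b) = star a + star b := (starLin 𝔽).map_add a b

theorem star_smul' (r : ℝ) (a : 𝔽) : star (r • a) = r • star a := (starLin 𝔽).map_smul r a

theorem star_zero' : star (0 : 𝔽) = 0 := (starLin 𝔽).map_zero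

theorem star_sum' {ι : Type*} (s : Finset ι) (f : ι → 𝔽) :
    star (∑ i ∈ s, f i) = ∑ i ∈ s, star (f i) := map_sum (starLin 𝔽) f s

theorem star_one' : star (1 : 𝔽) = 1 := by
  rw [star_eq', real_inner_self_eq_norm_sq, norm_one']
  norm_num [two_smul]

theorem star_star' (a : 𝔽) : star (star a) = a := by
  rw [star_eq' a]
  change starLin 𝔽 _ = a
  rw [map_sub, map_smul, starLin_apply, starLin_apply, star_one', star_eq' a, sub_sub_cancel]

/-- Polarisation of `norm_mul'` in the second factor. -/
theorem inner_mul_mul_left (a c d : 𝔽) : ⟪a * c, a * d⟫ = ‖a‖ ^ 2 * ⟪c, d⟫ := by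
  have h := congrArg (· ^ 2) (norm_mul' a (c + d))
  have h1 := congrArg (· ^ 2) (norm_mul' a c)
  have h2 := congrArg (· ^ 2) (norm_mul' a d)
  simp only [mul_add', mul_pow, norm_add_sq_real] at h h1 h2
  linarith

/-- A second polarisation, in the first factor. Setting one argument to `1` yields both adjunction
rules below. -/
theorem inner_mul_add_inner_mul (a b c d : 𝔽) :
    ⟪a * c, b * d⟫ + ⟪b * c, a * d⟫ = 2 * ⟪a, b⟫ * ⟪c, d⟫ := by
  have h := inner_mul_mul_left (a + b) c d
  simp only [add_mul', inner_add_left, inner_add_right, inner_mul_mul_left,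
    norm_add_sq_real] at h
  linarith

theorem inner_mul_left (a c b : 𝔽) : ⟪a * c, b⟫ = ⟪c, star a * b⟫ := by
  have h := inner_mul_add_inner_mul a 1 c b
  rw [one_mul', one_mul'] at h
  rw [star_eq', sub_mul', smul_mul', one_mul', inner_sub_right, inner_smul_right,
    real_inner_comm a (1 : 𝔽)]
  linarith

theorem inner_mul_right (a c b : 𝔽) : ⟪a * c, b⟫ = ⟪a, b * star c⟫ := by
  have h := inner_mul_add_inner_mul a b c 1
  rw [mul_one', mul_one', real_inner_comm a (b * c)] at h
  rw [star_eq', mul_sub', mul_smul', mul_one', inner_sub_right, inner_smul_right,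
    real_inner_comm c (1 : 𝔽)]
  linarith

/-- Tested against an arbitrary `t`, the factors are moved across the inner product one at a time,
so associativity is not needed. -/
theorem star_mul' (a b : 𝔽) : star (a * b) = star b * star a := by
  refine ext_inner_right ℝ fun t => ?_
  calc ⟪star (a * b), t⟫ = ⟪1, (a * b) * t⟫ := by
        rw [real_inner_comm _ (1 : 𝔽), inner_mul_left, mul_one', real_inner_comm]
    _ = ⟪star t, a * b⟫ := by
        rw [real_inner_comm, inner_mul_right, one_mul', real_inner_comm]
    _ = ⟪star t * star b, a⟫ := by
        rw [inner_mul_right (star t), star_star']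
    _ = ⟪star b, t * a⟫ := by rw [inner_mul_left, star_star']
    _ = ⟪star b * star a, t⟫ := by rw [inner_mul_right, star_star']

/-- Left alternativity: multiplication by `a` is a similarity, and its adjoint is multiplication by
`star a`. This is the substitute for associativity. -/
theorem star_mul_self_mul (a c : 𝔽) : star a * (a * c) = ‖a‖ ^ 2 • c := by
  refine ext_inner_left ℝ fun t => ?_
  rw [← inner_mul_left, inner_mul_mul_left, inner_smul_right]

theorem star_mul_self' (a : 𝔽) : star a * a = ‖a‖ ^ 2 • (1 : 𝔽) := by
  have h := star_mul_self_mul a 1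
  rwa [mul_one'] at h

theorem re_star_mul (a b : 𝔽) : re (star a * b) = ⟪a, b⟫ := by
  rw [re, ← inner_mul_left, mul_one']

theorem re_smul_one (r : ℝ) : re (r • (1 : 𝔽)) = r := by
  rw [re, inner_smul_right, real_inner_self_eq_norm_sq, norm_one']; norm_num

/-- The real part as a linear map. -/
def reLin (𝔽 : Type*) [NormedAddCommGroup 𝔽] [InnerProductSpace ℝ 𝔽] [One 𝔽] : 𝔽 →ₗ[ℝ] ℝ :=
  (innerSL ℝ (1 : 𝔽)).toLinearMap

theorem re_add (a b : 𝔽) : re (a + b) = re a + re b := (reLin 𝔽).map_add a b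

theorem re_sum {ι : Type*} (s : Finset ι) (f : ι → 𝔽) :
    re (∑ i ∈ s, f i) = ∑ i ∈ s, re (f i) := map_sum (reLin 𝔽) f s

theorem eq_re_smul_of_star_eq {a : 𝔽} (h : star a = a) : a = re a • (1 : 𝔽) := by
  rw [star_eq', sub_eq_iff_eq_add, ← two_smul ℝ a, mul_smul] at h
  exact (smul_right_injective 𝔽 (two_ne_zero' ℝ) h).symm

theorem star_smul_one (r : ℝ) : star (r • (1 : 𝔽)) = r • (1 : 𝔽) := by
  rw [star_smul', star_one']

theorem continuous_star' : Continuous (star : 𝔽 → 𝔽) := by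
  have : (star : 𝔽 → 𝔽) = fun a => (2 * ⟪(1 : 𝔽), a⟫) • (1 : 𝔽) - a := funext star_eq'
  rw [this]; fun_prop

theorem continuous_re : Continuous (re : 𝔽 → ℝ) := continuous_const.inner continuous_id

theorem continuous_mul' : Continuous fun p : 𝔽 × 𝔽 => p.1 * p.2 :=
  ((mulBilin 𝔽).mkContinuous₂ 1 fun a b => by
    rw [mulBilin_apply, norm_mul', one_mul]).continuous₂

theorem nontrivial' (𝔽 : Type*) [NormedAddCommGroup 𝔽] [InnerProductSpace ℝ 𝔽]
    [Mul 𝔽] [One 𝔽] [Star 𝔽] [NormedDivisionAlg 𝔽] : Nontrivial 𝔽 := ⟨1, 0, one_ne_zero'⟩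

theorem finrank_pos' (𝔽 : Type*) [NormedAddCommGroup 𝔽] [InnerProductSpace ℝ 𝔽]
    [FiniteDimensional ℝ 𝔽] [Mul 𝔽] [One 𝔽] [Star 𝔽] [NormedDivisionAlg 𝔽] :
    0 < Module.finrank ℝ 𝔽 := have := nontrivial' 𝔽; Module.finrank_pos

theorem beta_pos (𝔽 : Type*) [NormedAddCommGroup 𝔽] [InnerProductSpace ℝ 𝔽]
    [FiniteDimensional ℝ 𝔽] [Mul 𝔽] [One 𝔽] [Star 𝔽] [NormedDivisionAlg 𝔽] :
    0 < beta 𝔽 := Nat.cast_pos.2 (finrank_pos' 𝔽)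

end Algebra

end NormedDivisionAlg

end

noncomputable section
set_option linter.unusedSectionVars false

/-- Shears compose by adding `g`, and the shear of `2g` is conjugate to that of `g`. So the
determinant equals its own square, and it is invertible. -/
theorem LinearMap.det_shear {P Q : Type*} [AddCommGroup P] [Module ℝ P] [AddCommGroup Q]
    [Module ℝ Q] (g : Q →ₗ[ℝ] P) :
    LinearMap.det ((LinearMap.fst ℝ P Q + g ∘ₗ LinearMap.snd ℝ P Q).prod (LinearMap.snd ℝ P Q))
      = 1 := by
  set S : (Q →ₗ[ℝ] P) → (P × Q →ₗ[ℝ] P × Q) := fun g =>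
    (LinearMap.fst ℝ P Q + g ∘ₗ LinearMap.snd ℝ P Q).prod (LinearMap.snd ℝ P Q) with hS
  have hadd : ∀ g₁ g₂, S (g₁ + g₂) = S g₁ * S g₂ := fun g₁ g₂ => by
    refine LinearMap.ext fun x => ?_
    simp only [hS, LinearMap.prod_apply, Function.prod_apply, LinearMap.add_apply,
      LinearMap.fst_apply, Module.End.mul_apply, LinearMap.coe_comp, Function.comp_apply, LinearMap.snd_apply, Prod.mk.injEq, and_true]
    abel
  -- Doubling the first factor conjugates the shear of `g` into that of `g + g`.
  let D : (P × Q) ≃ₗ[ℝ] (P × Q) :=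
    LinearEquiv.prodCongr (LinearEquiv.smulOfNeZero ℝ P (2 : ℝ) two_ne_zero) (LinearEquiv.refl ℝ Q)
  have hconj : (D : P × Q →ₗ[ℝ] P × Q) ∘ₗ S g ∘ₗ (D.symm : P × Q →ₗ[ℝ] P × Q) = S (g + g) := by
    refine LinearMap.ext fun x => ?_
    obtain ⟨y, rfl⟩ := D.surjective x
    have hD : ∀ p, D p = ((2 : ℝ) • p.1, p.2) := fun p => rfl
    simp only [LinearMap.comp_apply, LinearEquiv.coe_coe, LinearEquiv.symm_apply_apply]
    rw [hD, hD]
    simp only [hS, LinearMap.prod_apply, Function.prod_apply, LinearMap.add_apply,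
      LinearMap.fst_apply, LinearMap.coe_comp, Function.comp_apply, LinearMap.snd_apply,
      smul_add, two_smul]
  have h0 : S 0 = LinearMap.id := by
    refine LinearMap.ext fun x => ?_
    simp [hS]
  have h1 : LinearMap.det (S g) * LinearMap.det (S (-g)) = 1 := by
    rw [← map_mul, ← hadd, add_neg_cancel, h0, LinearMap.det_id]
  have h2 : LinearMap.det (S g) * LinearMap.det (S g) = LinearMap.det (S g) := by
    rw [← map_mul, ← hadd, ← hconj, LinearMap.det_conj]
  exact mul_left_cancel₀ (left_ne_zero_of_mul_eq_one h1) (h2.trans (mul_one _).symm)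

namespace NormedDivisionAlg

open scoped RealInnerProductSpace

/-! ### Schur complements: positivity and determinant of bordered matrices -/

section Bordered

variable {𝔽 : Type*} [NormedAddCommGroup 𝔽] [InnerProductSpace ℝ 𝔽] [FiniteDimensional ℝ 𝔽]
  [Mul 𝔽] [One 𝔽] [Star 𝔽] [NormedDivisionAlg 𝔽]

/-- The condition under which `m × m` Hermitian matrices over `𝔽` are well behaved. -/
def AssocOrSmall (𝔽 : Type*) [Mul 𝔽] (m : ℕ) : Prop :=
  (∀ a b c : 𝔽, a * b * c = a * (b * c)) ∨ m ≤ 2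

theorem AssocOrSmall.pred {m : ℕ} (h : AssocOrSmall 𝔽 (m + 1)) : AssocOrSmall 𝔽 m :=
  h.imp_right fun h => by omega

/-- Without associativity `m ≤ 1`, so `i = j` and alternativity applies. The block calculus for
bordered matrices needs no other instance of associativity. -/
theorem AssocOrSmall.star_mul_mul {m : ℕ} (h : AssocOrSmall 𝔽 (m + 1)) (v : Fin m → 𝔽)
    (i j : Fin m) (c : 𝔽) : star (v i) * v j * c = star (v i) * (v j * c) := by
  rcases h with h | h
  · exact h _ _ _
  · obtain rfl : i = j := by ext; omega
    rw [star_mul_self', smul_mul', one_mul', star_mul_self_mul]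

/-- The Hermitian matrix `[r, v; vᴴ, A]`. -/
def bordered {m : ℕ} (r : ℝ) (v : Fin m → 𝔽) (A : Matrix (Fin m) (Fin m) 𝔽) :
    Matrix (Fin (m + 1)) (Fin (m + 1)) 𝔽 :=
  Matrix.of (Fin.cons (Fin.cons (r • 1) v) fun i => Fin.cons (star (v i)) (A i))

/-- The matrix `vᴴ v / r`, to be subtracted from `A` to get the Schur complement of the corner
of `[r, v; vᴴ, A]`. -/
def schurTerm {m : ℕ} (r : ℝ) (v : Fin m → 𝔽) : Matrix (Fin m) (Fin m) 𝔽 :=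
  Matrix.of fun i j => r⁻¹ • (star (v i) * v j)

section entries

variable {m : ℕ} (r : ℝ) (v : Fin m → 𝔽) (A : Matrix (Fin m) (Fin m) 𝔽) (i j : Fin m)

@[simp] theorem bordered_zero_zero : bordered r v A 0 0 = r • (1 : 𝔽) := rfl
@[simp] theorem bordered_zero_succ : bordered r v A 0 j.succ = v j := rfl
@[simp] theorem bordered_succ_zero : bordered r v A i.succ 0 = star (v i) := rfl
@[simp] theorem bordered_succ_succ : bordered r v A i.succ j.succ = A i j := rfl
theorem schurTerm_apply : schurTerm r v i j = r⁻¹ • (star (v i) * v j) := rfl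

end entries

theorem mulVecLin_apply {m : ℕ} (A : Matrix (Fin m) (Fin m) 𝔽) (v : Fin m → 𝔽) (i : Fin m) :
    mulVecLin A v i = ∑ j, A i j * v j := rfl

theorem isHermitian_schurTerm {m : ℕ} (r : ℝ) (v : Fin m → 𝔽) (i j : Fin m) :
    star (schurTerm r v i j) = schurTerm r v j i := by
  rw [schurTerm_apply, schurTerm_apply, star_smul', star_mul', star_star']

theorem isHermitian_iff {m : ℕ} {A : Matrix (Fin m) (Fin m) 𝔽} :
    A.IsHermitian ↔ ∀ i j, star (A i j) = A j i := by
  rw [Matrix.IsHermitian, ← Matrix.ext_iff]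
  exact forall_comm

theorem isHermitian_bordered_iff {m : ℕ} {r : ℝ} {v : Fin m → 𝔽} {A : Matrix (Fin m) (Fin m) 𝔽} :
    (bordered r v A).IsHermitian ↔ (A - schurTerm r v).IsHermitian := by
  simp only [isHermitian_iff, Matrix.sub_apply]
  have hsub : ∀ a b : 𝔽, star (a - b) = star a - star b := (starLin 𝔽).map_sub
  constructor
  · intro h i j
    have := h i.succ j.succ
    rw [hsub, isHermitian_schurTerm]
    simp only [bordered_succ_succ] at this
    rw [this]
  · intro h i j
    refine Fin.cases ?_ (fun i => ?_) i <;> refine Fin.cases ?_ (fun j => ?_) j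
    · simp [star_smul_one]
    · simp
    · simp [star_star']
    · have := h i j
      rw [hsub, isHermitian_schurTerm, sub_left_inj] at this
      simpa using this

/-- The quadratic form `vᴴ (A v)`. -/
def quadForm {m : ℕ} (A : Matrix (Fin m) (Fin m) 𝔽) (v : Fin m → 𝔽) : ℝ :=
  re (∑ i, star (v i) * mulVecLin A v i)

theorem mem_posDefCone_iff {m : ℕ} {A : Matrix (Fin m) (Fin m) 𝔽} :
    A ∈ posDefCone 𝔽 m ↔ A.IsHermitian ∧ ∀ v, v ≠ 0 → 0 < quadForm A v := Iff.rfl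

theorem quadForm_eq {m : ℕ} (A : Matrix (Fin m) (Fin m) 𝔽) (v : Fin m → 𝔽) :
    quadForm A v = ∑ i, ⟪v i, mulVecLin A v i⟫ := by
  simp only [quadForm, re_sum, re_star_mul]

theorem mulVecLin_bordered_zero {m : ℕ} (r : ℝ) (v : Fin m → 𝔽) (A : Matrix (Fin m) (Fin m) 𝔽)
    (t : 𝔽) (w : Fin m → 𝔽) :
    mulVecLin (bordered r v A) (Fin.cons t w : Fin (m + 1) → 𝔽) 0
      = r • t + ∑ j, v j * w j := by
  simp [mulVecLin_apply, Fin.sum_univ_succ, smul_mul', one_mul']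

theorem mulVecLin_bordered_succ {m : ℕ} (hm : AssocOrSmall 𝔽 (m + 1)) (r : ℝ) (v : Fin m → 𝔽) (A : Matrix (Fin m) (Fin m) 𝔽) (t : 𝔽) (w : Fin m → 𝔽) (i : Fin m) :
    mulVecLin (bordered r v A) (Fin.cons t w : Fin (m + 1) → 𝔽) i.succ
      = star (v i) * (t + r⁻¹ • ∑ j, v j * w j) + mulVecLin (A - schurTerm r v) w i := by
  simp only [mulVecLin_apply, Fin.sum_univ_succ, Fin.cons_zero, Fin.cons_succ, Matrix.sub_apply,
    bordered_succ_zero, bordered_succ_succ, schurTerm_apply, sub_mul', smul_mul',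
    hm.star_mul_mul, Finset.sum_sub_distrib, mul_add', mul_smul', mul_sum', Finset.smul_sum]
  abel

/-- Completing the square in the first coordinate `t`. -/
theorem quadForm_bordered {m : ℕ} (hm : AssocOrSmall 𝔽 (m + 1)) {r : ℝ} (hr : r ≠ 0)
    (v : Fin m → 𝔽) (A : Matrix (Fin m) (Fin m) 𝔽) (t : 𝔽) (w : Fin m → 𝔽) :
    quadForm (bordered r v A) (Fin.cons t w : Fin (m + 1) → 𝔽)
      = r * ‖t + r⁻¹ • ∑ j, v j * w j‖ ^ 2 + quadForm (A - schurTerm r v) w := by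
  set u := t + r⁻¹ • ∑ j, v j * w j with hu
  have ht : r • t + ∑ j, v j * w j = r • u := by
    rw [hu, smul_add, smul_smul, mul_inv_cancel₀ hr, one_smul]
  have hs : ∑ i, ⟪w i, star (v i) * u⟫ = ⟪∑ j, v j * w j, u⟫ := by
    simp only [← inner_mul_left, sum_inner]
  have hw : ∑ j, v j * w j = r • u - r • t := by rw [← ht]; abel
  rw [quadForm_eq, Fin.sum_univ_succ, quadForm_eq, mulVecLin_bordered_zero]
  simp only [mulVecLin_bordered_succ hm, Fin.cons_zero, Fin.cons_succ, inner_add_right (w _),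
    Finset.sum_add_distrib]
  rw [ht, ← hu, hs, hw, inner_sub_left, inner_smul_left, inner_smul_left, inner_smul_right,
    real_inner_self_eq_norm_sq]
  simp
  ring

theorem quadForm_bordered_single (m : ℕ) (r : ℝ) (v : Fin m → 𝔽) (A : Matrix (Fin m) (Fin m) 𝔽) :
    quadForm (bordered r v A) (Fin.cons 1 0 : Fin (m + 1) → 𝔽) = r := by
  rw [quadForm_eq, Fin.sum_univ_succ, mulVecLin_bordered_zero]
  simp [mul_zero', inner_smul_right, norm_one']

theorem bordered_mem_posDefCone_iff {m : ℕ} (hm : AssocOrSmall 𝔽 (m + 1)) {r : ℝ} {v : Fin m → 𝔽}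
    {A : Matrix (Fin m) (Fin m) 𝔽} :
    bordered r v A ∈ posDefCone 𝔽 (m + 1) ↔ 0 < r ∧ A - schurTerm r v ∈ posDefCone 𝔽 m := by
  rw [mem_posDefCone_iff, mem_posDefCone_iff, isHermitian_bordered_iff]
  constructor
  · rintro ⟨hH, hpos⟩
    have hr : 0 < r := by
      rw [← quadForm_bordered_single m r v A]
      refine hpos _ fun h => one_ne_zero' (𝔽 := 𝔽) ?_
      simpa using congrFun h 0
    refine ⟨hr, hH, fun w hw => ?_⟩
    -- This first coordinate makes the completed square vanish, leaving the form of the Schur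
    -- complement.
    have h := hpos (Fin.cons (-(r⁻¹ • ∑ j, v j * w j)) w) fun h => hw <| funext fun i => by
      simpa using congrFun h i.succ
    rw [quadForm_bordered hm hr.ne'] at h
    simpa using h
  · rintro ⟨hr, hH, hpos⟩
    refine ⟨hH, fun x hx => ?_⟩
    rw [← Fin.cons_self_tail x, quadForm_bordered hm hr.ne']
    rcases eq_or_ne (Fin.tail x) 0 with h0 | h0
    · have hx0 : x 0 ≠ 0 := fun h => hx <| funext fun i => by
        refine Fin.cases h (fun i => ?_) i
        exact congrFun h0 i
      rw [h0]
      have : quadForm (A - schurTerm r v) 0 = 0 := by simp [quadForm_eq]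
      rw [this]
      simp only [Pi.zero_apply, mul_zero', Finset.sum_const_zero, smul_zero, add_zero]
      have := norm_pos_iff.2 hx0
      positivity
    · have := hpos _ h0
      positivity

/-- Block elimination: the map is a lower shear, times a block diagonal map, times an upper shear.
The corner acts as `r` on `𝔽`, whence the power of `r`. -/
theorem det_mulVecLin_bordered {m : ℕ} (hm : AssocOrSmall 𝔽 (m + 1)) {r : ℝ} (hr : r ≠ 0)
    (v : Fin m → 𝔽) (A : Matrix (Fin m) (Fin m) 𝔽) :
    LinearMap.det (mulVecLin (bordered r v A))
      = r ^ Module.finrank ℝ 𝔽 * LinearMap.det (mulVecLin (A - schurTerm r v)) := by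
  let e : (𝔽 × (Fin m → 𝔽)) ≃ₗ[ℝ] (Fin (m + 1) → 𝔽) := Fin.consLinearEquiv ℝ fun _ => 𝔽
  let g : (Fin m → 𝔽) →ₗ[ℝ] 𝔽 := r⁻¹ • ∑ j, mulBilin 𝔽 (v j) ∘ₗ LinearMap.proj j
  -- The factor `r⁻¹` undoes the scaling by `r` in `D`, which acts before this shear. `S₂` lives on
  -- the swapped product so that `LinearMap.det_shear` covers both shears.
  let k : 𝔽 →ₗ[ℝ] (Fin m → 𝔽) := r⁻¹ • LinearMap.pi fun i => mulBilin 𝔽 (star (v i))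
  let S₁ := (LinearMap.fst ℝ 𝔽 (Fin m → 𝔽) + g ∘ₗ LinearMap.snd ℝ _ _).prod (LinearMap.snd ℝ _ _)
  let S₂ := (LinearMap.fst ℝ (Fin m → 𝔽) 𝔽 + k ∘ₗ LinearMap.snd ℝ _ _).prod (LinearMap.snd ℝ _ _)
  let c : ((Fin m → 𝔽) × 𝔽) ≃ₗ[ℝ] (𝔽 × (Fin m → 𝔽)) := LinearEquiv.prodComm ℝ _ _
  let D := (r • LinearMap.id (R := ℝ) (M := 𝔽)).prodMap (mulVecLin (A - schurTerm r v))
  have key : mulVecLin (bordered r v A)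
      = (e : _ →ₗ[ℝ] _) ∘ₗ (((c : _ →ₗ[ℝ] _) ∘ₗ S₂ ∘ₗ (c.symm : _ →ₗ[ℝ] _)) * D * S₁)
        ∘ₗ (e.symm : _ →ₗ[ℝ] _) := by
    refine LinearMap.ext fun x => ?_
    obtain ⟨⟨t, w⟩, rfl⟩ := e.surjective x
    have he : ∀ p, e p = (Fin.cons p.1 p.2 : Fin (m + 1) → 𝔽) := fun p => rfl
    simp only [LinearMap.comp_apply, LinearEquiv.coe_coe, LinearEquiv.symm_apply_apply,
      Module.End.mul_apply]
    have hg : g w = r⁻¹ • ∑ j, v j * w j := by simp [g]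
    have h1 : S₁ (t, w) = (t + r⁻¹ • ∑ j, v j * w j, w) := by simp [S₁, hg]
    set u := t + r⁻¹ • ∑ j, v j * w j with hu
    rw [h1]
    have h2 : D (u, w) = (r • u, mulVecLin (A - schurTerm r v) w) := by simp [D]
    have h3 : c (S₂ (c.symm (r • u, mulVecLin (A - schurTerm r v) w)))
        = (r • u, mulVecLin (A - schurTerm r v) w + k (r • u)) := by simp [c, S₂]
    rw [h2, h3, he, he]
    refine funext fun i => Fin.cases ?_ (fun i => ?_) i
    · rw [mulVecLin_bordered_zero]
      simp [hu, smul_smul, hr]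
    · rw [mulVecLin_bordered_succ hm, ← hu]
      simp [k, smul_smul, hr, add_comm]
  rw [key, LinearMap.det_conj, map_mul, map_mul, LinearMap.det_conj, LinearMap.det_shear,
    LinearMap.det_shear, LinearMap.det_prodMap, LinearMap.det_smul, LinearMap.det_id]
  ring

/-- The Hermitian matrices of size `m + 1` are bordered Hermitian matrices of size `m`. -/
theorem eq_bordered_of_isHermitian {m : ℕ} {A : Matrix (Fin (m + 1)) (Fin (m + 1)) 𝔽}
    (hA : A.IsHermitian) :
    A = bordered (re (A 0 0)) (fun j => A 0 j.succ) (Matrix.of fun i j => A i.succ j.succ) := by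
  rw [isHermitian_iff] at hA
  refine Matrix.ext fun i j => ?_
  refine Fin.cases ?_ (fun i => ?_) i <;> refine Fin.cases ?_ (fun j => ?_) j
  · exact eq_re_smul_of_star_eq (hA 0 0)
  · rfl
  · exact (hA _ _).symm
  · rfl

theorem det_mulVecLin_pos {m : ℕ} (hm : AssocOrSmall 𝔽 m) {A : Matrix (Fin m) (Fin m) 𝔽}
    (hA : A ∈ posDefCone 𝔽 m) : 0 < LinearMap.det (mulVecLin A) := by
  induction m with
  | zero =>
    rw [LinearMap.det_eq_one_of_subsingleton]; exact one_pos
  | succ m ih =>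
    have hA' := hA
    rw [eq_bordered_of_isHermitian hA.1] at hA' ⊢
    obtain ⟨hr, hS⟩ := (bordered_mem_posDefCone_iff hm).1 hA'
    rw [det_mulVecLin_bordered hm hr.ne']
    exact mul_pos (pow_pos hr _) (ih hm.pred hS)

theorem hdet_pos {m : ℕ} (hm : AssocOrSmall 𝔽 m) {A : Matrix (Fin m) (Fin m) 𝔽}
    (hA : A ∈ posDefCone 𝔽 m) : 0 < hdet A := Real.rpow_pos_of_pos (det_mulVecLin_pos hm hA) _

/-- Positivity of both factors is what allows the real power `1 / β` to be distributed. -/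
theorem hdet_bordered {m : ℕ} (hm : AssocOrSmall 𝔽 (m + 1)) {r : ℝ} {v : Fin m → 𝔽}
    {A : Matrix (Fin m) (Fin m) 𝔽} (hr : 0 < r) (hA : A - schurTerm r v ∈ posDefCone 𝔽 m) :
    hdet (bordered r v A) = r * hdet (A - schurTerm r v) := by
  rw [hdet, hdet, det_mulVecLin_bordered hm hr.ne',
    Real.mul_rpow (pow_nonneg hr.le _) (det_mulVecLin_pos hm.pred hA).le, ← Real.rpow_natCast,
    ← Real.rpow_mul hr.le]
  change r ^ (beta 𝔽 * (1 / beta 𝔽)) * _ = _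
  rw [mul_one_div_cancel (beta_pos 𝔽).ne', Real.rpow_one]

end Bordered

end NormedDivisionAlg

end

noncomputable section
set_option linter.unusedSectionVars false

open scoped ENNReal RealInnerProductSpace
open Set (Ioi)

/-! ### Polar coordinates -/

section Lebesgue

theorem lintegral_pi_fin_succ {α : Type*} [MeasurableSpace α] (μ : Measure α) [SigmaFinite μ]
    {m : ℕ} {f : (Fin (m + 1) → α) → ℝ≥0∞} (hf : Measurable f) :
    ∫⁻ x, f x ∂(Measure.pi fun _ => μ)
      = ∫⁻ a, ∫⁻ y : Fin m → α, f (Fin.cons a y) ∂(Measure.pi fun _ => μ) ∂μ := by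
  have h := (measurePreserving_piFinSuccAbove (fun _ : Fin (m + 1) => μ) 0).symm
  rw [← h.lintegral_comp hf, lintegral_prod]
  · refine lintegral_congr fun a => lintegral_congr fun y => ?_
    rw [show (MeasurableEquiv.piFinSuccAbove (fun _ => α) 0).symm (a, y)
      = Fin.insertNth (α := fun _ => α) 0 a y from rfl, Fin.insertNth_zero']
  · exact (hf.comp h.measurable).aemeasurable

theorem lintegral_Ioi_comp_sq (g : ℝ → ℝ≥0∞) :
    ∫⁻ s in Ioi (0 : ℝ), g s = ∫⁻ r in Ioi (0 : ℝ), ENNReal.ofReal (2 * r) * g (r ^ 2) := by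
  have himg : (fun r : ℝ => r ^ 2) '' Ioi 0 = Ioi 0 := by
    ext s
    constructor
    · rintro ⟨r, hr, rfl⟩
      exact pow_pos (Set.mem_Ioi.1 hr) 2
    · intro hs
      exact ⟨√s, Real.sqrt_pos.2 hs, Real.sq_sqrt (le_of_lt hs)⟩
  have hinj : Set.InjOn (fun r : ℝ => r ^ 2) (Ioi 0) := fun a ha b hb h =>
    (sq_eq_sq₀ (le_of_lt ha) (le_of_lt hb)).1 h
  have hd : ∀ x ∈ Ioi (0 : ℝ), HasDerivWithinAt (fun r : ℝ => r ^ 2) (2 * x) (Ioi 0) x :=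
    fun x _ => by simpa using (hasDerivAt_pow 2 x).hasDerivWithinAt
  have h := lintegral_image_eq_lintegral_abs_deriv_mul measurableSet_Ioi hd hinj g
  rw [himg] at h
  rw [h]
  refine setLIntegral_congr_fun measurableSet_Ioi fun r hr => ?_
  have hr' : 0 < r := hr
  simp only [abs_of_pos (mul_pos two_pos hr')]

/-- Polar coordinates in a model space of dimension `D`, transported by an isometry. `K` is chosen
before `E`: in the induction the space varies with the first column, and the constant must not. -/
theorem exists_lintegral_norm_sq {D : ℕ} (hD : 0 < D) :
    ∃ K : ℝ≥0∞, ∀ {E : Type*} [NormedAddCommGroup E] [InnerProductSpace ℝ E] [FiniteDimensional ℝ E]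
        [MeasurableSpace E] [BorelSpace E], Module.finrank ℝ E = D →
      ∀ {Ψ : ℝ → ℝ≥0∞}, Measurable Ψ → ∫⁻ x : E, Ψ (‖x‖ ^ 2)
        = K * ∫⁻ s in Ioi (0 : ℝ), ENNReal.ofReal (s ^ ((D : ℝ) / 2 - 1)) * Ψ s := by
  have : Nonempty (Fin D) := ⟨⟨0, hD⟩⟩
  set H := EuclideanSpace ℝ (Fin D)
  have hH : Module.finrank ℝ H = D := finrank_euclideanSpace_fin
  set S : ℝ≥0∞ := (volume : Measure H).toSphere Set.univ
  -- The area of the unit sphere, halved because `s = r²` gives `ds = 2 r dr`.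
  refine ⟨S * 2⁻¹, ?_⟩
  intro E _ _ _ _ _ hE Ψ hΨ
  let e : E ≃ₗᵢ[ℝ] H := ((stdOrthonormalBasis ℝ E).reindex (finCongr hE)).repr
  have h1 : ∫⁻ x : E, Ψ (‖x‖ ^ 2) = ∫⁻ x : H, Ψ (‖x‖ ^ 2) := by
    rw [← e.measurePreserving.lintegral_comp (by fun_prop)]
    simp only [LinearIsometryEquiv.norm_map]
  have h2 : ∫⁻ x : H, Ψ (‖x‖ ^ 2)
      = S * ∫⁻ r in Ioi (0 : ℝ), ENNReal.ofReal (r ^ (D - 1)) * Ψ (r ^ 2) := by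
    have hmp := (volume : Measure H).measurePreserving_homeomorphUnitSphereProd
    calc ∫⁻ x : H, Ψ (‖x‖ ^ 2)
        = ∫⁻ x : ({(0 : H)}ᶜ : Set H), Ψ (‖x.1‖ ^ 2) ∂(volume.comap Subtype.val) := by
          rw [lintegral_subtype_comap (measurableSet_singleton _).compl fun x : H => Ψ (‖x‖ ^ 2),
            restrict_compl_singleton]
      _ = ∫⁻ p, Ψ (p.2.1 ^ 2) ∂((volume : Measure H).toSphere.prod
            (Measure.volumeIoiPow (Module.finrank ℝ H - 1))) := by
          rw [← hmp.lintegral_comp (by fun_prop)]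
          simp
      _ = S * ∫⁻ r : Ioi (0 : ℝ), Ψ (r.1 ^ 2)
            ∂(Measure.volumeIoiPow (Module.finrank ℝ H - 1)) := by
          rw [lintegral_prod _ (by fun_prop)]
          simp only [lintegral_const]
          rw [mul_comm]
      _ = _ := by
          rw [hH, Measure.volumeIoiPow, lintegral_withDensity_eq_lintegral_mul _ (by fun_prop)
            (by fun_prop)]
          exact congrArg _ (lintegral_subtype_comap measurableSet_Ioi
            fun r : ℝ => ENNReal.ofReal (r ^ (D - 1)) * Ψ (r ^ 2))
  rw [h1, h2, lintegral_Ioi_comp_sq fun s => ENNReal.ofReal (s ^ ((D : ℝ) / 2 - 1)) * Ψ s,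
    mul_assoc]
  congr 1
  rw [← lintegral_const_mul _ (by fun_prop)]
  refine setLIntegral_congr_fun measurableSet_Ioi fun r hr => ?_
  have hr' : 0 < r := hr
  have hpow : (r ^ 2) ^ ((D : ℝ) / 2 - 1) * r = r ^ (D - 1) := by
    rw [← Real.rpow_natCast r 2, ← Real.rpow_mul hr'.le, ← Real.rpow_natCast r (D - 1),
      Nat.cast_pred hD, ← Real.rpow_add_one hr'.ne']
    congr 1; push_cast; ring
  have h2 : (2 : ℝ≥0∞)⁻¹ * ENNReal.ofReal (2 * r) = ENNReal.ofReal r := by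
    rw [ENNReal.ofReal_mul zero_le_two, ← mul_assoc, ENNReal.ofReal_ofNat,
      ENNReal.inv_mul_cancel (by simp) (by simp), one_mul]
  rw [← hpow, ENNReal.ofReal_mul (by positivity), ← mul_assoc, ← mul_assoc, h2]
  ring

end Lebesgue

namespace NormedDivisionAlg

/-! ### Measurability of the determinant and of the cone -/

section Measurability

theorem measurable_matrix_iff {α γ ι κ : Type*} [MeasurableSpace α] [MeasurableSpace γ]
    {f : γ → Matrix ι κ α} : Measurable f ↔ ∀ i j, Measurable fun x => f x i j :=
  (measurable_pi_iff (g := fun x i => (f x i : κ → α))).trans <|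
    forall_congr' fun _ => measurable_pi_iff

theorem measurable_matrix_apply {α ι κ : Type*} [MeasurableSpace α] (i : ι) (j : κ) :
    Measurable fun A : Matrix ι κ α => A i j :=
  (measurable_matrix_iff (f := fun A : Matrix ι κ α => A)).1 measurable_id i j

variable {𝔽 : Type*} [NormedAddCommGroup 𝔽] [InnerProductSpace ℝ 𝔽] [FiniteDimensional ℝ 𝔽]
  [Mul 𝔽] [One 𝔽] [Star 𝔽] [NormedDivisionAlg 𝔽] [MeasurableSpace 𝔽] [BorelSpace 𝔽]
  {γ : Type*} [MeasurableSpace γ]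

theorem measurable_mul' {f g : γ → 𝔽} (hf : Measurable f) (hg : Measurable g) :
    Measurable fun x => f x * g x := by
  have := FiniteDimensional.proper_real 𝔽
  exact continuous_mul'.measurable.comp (hf.prodMk hg)

theorem measurable_star' : Measurable (star : 𝔽 → 𝔽) := continuous_star'.measurable

theorem measurable_re : Measurable (re : 𝔽 → ℝ) := continuous_re.measurable

theorem measurable_smul' {f : γ → ℝ} {g : γ → 𝔽} (hf : Measurable f) (hg : Measurable g) :
    Measurable fun x => f x • g x := by
  have := FiniteDimensional.proper_real 𝔽
  exact hf.smul hg

theorem measurable_sub_matrix {m : ℕ} {f g : γ → Matrix (Fin m) (Fin m) 𝔽} (hf : Measurable f)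
    (hg : Measurable g) : Measurable fun x => f x - g x := by
  have := FiniteDimensional.proper_real 𝔽
  rw [measurable_matrix_iff] at *
  exact fun i j => (hf i j).sub (hg i j)

theorem measurable_add_matrix {m : ℕ} {f g : γ → Matrix (Fin m) (Fin m) 𝔽} (hf : Measurable f)
    (hg : Measurable g) : Measurable fun x => f x + g x := by
  have := FiniteDimensional.proper_real 𝔽
  rw [measurable_matrix_iff] at *
  exact fun i j => (hf i j).add (hg i j)

theorem measurable_schurTerm {m : ℕ} {r : γ → ℝ} {v : γ → Fin m → 𝔽} (hr : Measurable r)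
    (hv : Measurable v) : Measurable fun x => schurTerm (r x) (v x) := by
  rw [measurable_pi_iff] at hv
  exact measurable_matrix_iff.2 fun i j =>
    measurable_smul' hr.inv (measurable_mul' (measurable_star'.comp (hv i)) (hv j))

theorem measurable_bordered {m : ℕ} {r : γ → ℝ} {v : γ → Fin m → 𝔽}
    {A : γ → Matrix (Fin m) (Fin m) 𝔽} (hr : Measurable r) (hv : Measurable v)
    (hA : Measurable A) : Measurable fun x => bordered (r x) (v x) (A x) := by
  rw [measurable_pi_iff] at hv
  rw [measurable_matrix_iff] at *
  intro i j
  refine Fin.cases ?_ (fun i => ?_) i <;> refine Fin.cases ?_ (fun j => ?_) j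
  · exact measurable_smul' hr measurable_const
  · exact hv j
  · exact measurable_star'.comp (hv i)
  · exact hA i j

theorem measurable_mulVecLin_apply {m : ℕ} (v : Fin m → 𝔽) :
    Measurable fun A : Matrix (Fin m) (Fin m) 𝔽 => mulVecLin A v := by
  have := FiniteDimensional.proper_real 𝔽
  refine measurable_pi_iff.2 fun i => ?_
  simp only [mulVecLin_apply]
  exact Finset.measurable_fun_sum _ fun j _ =>
    measurable_mul' (measurable_matrix_apply i j) measurable_const

/-- In a real basis, the real determinant is a polynomial in measurable matrix coefficients. -/
theorem measurable_hdet {m : ℕ} : Measurable (hdet : Matrix (Fin m) (Fin m) 𝔽 → ℝ) := by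
  have := FiniteDimensional.proper_real 𝔽
  let b := Module.finBasis ℝ (Fin m → 𝔽)
  have h : ∀ A : Matrix (Fin m) (Fin m) 𝔽, LinearMap.det (mulVecLin A)
      = (LinearMap.toMatrix b b (mulVecLin A)).det := fun A => (LinearMap.det_toMatrix b _).symm
  have hent : ∀ i j, Measurable fun A : Matrix (Fin m) (Fin m) 𝔽 =>
      LinearMap.toMatrix b b (mulVecLin A) i j := fun i j => by
    simp only [LinearMap.toMatrix_apply]
    exact (b.coord i).continuous_of_finiteDimensional.measurable.comp
      (measurable_mulVecLin_apply (b j))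
  unfold hdet
  refine Measurable.pow_const ?_ _
  simp only [h, Matrix.det_apply]
  exact Finset.measurable_fun_sum _ fun σ _ =>
    (Finset.measurable_fun_prod _ fun i _ => hent _ _).const_smul _

/-- The definition quantifies over uncountably many vectors. The Schur complement criterion replaces
it by a recursion with finitely many measurable conditions. -/
theorem measurableSet_posDefCone {m : ℕ} (hm : AssocOrSmall 𝔽 m) :
    MeasurableSet (posDefCone 𝔽 m) := by
  have := FiniteDimensional.proper_real 𝔽
  induction m with
  | zero =>
    have : posDefCone 𝔽 0 = Set.univ := Set.eq_univ_of_forall fun A =>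
      ⟨Subsingleton.elim _ _, fun v hv => absurd (Subsingleton.elim v 0) hv⟩
    rw [this]
    exact MeasurableSet.univ
  | succ m ih =>
    have hH : MeasurableSet {A : Matrix (Fin (m + 1)) (Fin (m + 1)) 𝔽 | A.IsHermitian} := by
      simp only [isHermitian_iff, Set.ofPred_forall]
      exact MeasurableSet.iInter fun i => MeasurableSet.iInter fun j =>
        measurableSet_eq_fun (measurable_star'.comp (measurable_matrix_apply i j))
          (measurable_matrix_apply j i)
    have hr : Measurable fun A : Matrix (Fin (m + 1)) (Fin (m + 1)) 𝔽 => re (A 0 0) :=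
      measurable_re.comp (measurable_matrix_apply 0 0)
    have hv : Measurable fun (A : Matrix (Fin (m + 1)) (Fin (m + 1)) 𝔽) (j : Fin m) =>
        A 0 j.succ := measurable_pi_iff.2 fun j => measurable_matrix_apply 0 j.succ
    have hA : Measurable fun A : Matrix (Fin (m + 1)) (Fin (m + 1)) 𝔽 =>
        Matrix.of fun i j : Fin m => A i.succ j.succ :=
      measurable_matrix_iff.2 fun i j => measurable_matrix_apply i.succ j.succ
    have key : posDefCone 𝔽 (m + 1) = {A | A.IsHermitian} ∩ {A | 0 < re (A 0 0)} ∩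
        (fun A => (Matrix.of fun i j : Fin m => A i.succ j.succ)
          - schurTerm (re (A 0 0)) fun j => A 0 j.succ) ⁻¹' posDefCone 𝔽 m := by
      ext A
      rw [Set.inter_assoc, Set.mem_inter_iff, Set.mem_inter_iff, Set.mem_preimage]
      simp only [Set.mem_ofPred_eq]
      rw [← bordered_mem_posDefCone_iff hm]
      constructor
      · intro h
        exact ⟨h.1, by rwa [← eq_bordered_of_isHermitian h.1]⟩
      · rintro ⟨h, h'⟩
        rwa [← eq_bordered_of_isHermitian h] at h'
    rw [key]
    exact (hH.inter (measurableSet_lt measurable_const hr)).inter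
      (measurable_sub_matrix hA (measurable_schurTerm hr hv) (ih hm.pred))

end Measurability

/-! ### Lebesgue measure on Hermitian matrices in bordered coordinates -/

section HermVolume

variable {𝔽 : Type*} [NormedAddCommGroup 𝔽] [InnerProductSpace ℝ 𝔽] [FiniteDimensional ℝ 𝔽]
  [Mul 𝔽] [One 𝔽] [Star 𝔽] [NormedDivisionAlg 𝔽] [MeasurableSpace 𝔽] [BorelSpace 𝔽]

theorem measurable_hermOf {m : ℕ} : Measurable (hermOf 𝔽 (m := m)) := by
  refine measurable_matrix_iff.2 fun i j => ?_
  simp only [hermOf, Matrix.of_apply]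
  split_ifs with h h'
  · fun_prop
  · exact measurable_star'.comp (by fun_prop)
  · exact measurable_smul' (by fun_prop) measurable_const

instance {m : ℕ} : SFinite (hermVolume 𝔽 m) := by
  unfold hermVolume; infer_instance

theorem lintegral_hermVolume {m : ℕ} {f : Matrix (Fin m) (Fin m) 𝔽 → ℝ≥0∞} (hf : Measurable f) :
    ∫⁻ A, f A ∂(hermVolume 𝔽 m) = ∫⁻ p, f (hermOf 𝔽 p)
      ∂((Measure.pi fun _ : Fin m => (volume : Measure ℝ)).prod
        (Measure.pi fun _ : {q : Fin m × Fin m // q.1 < q.2} => (volume : Measure 𝔽))) :=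
  lintegral_map hf measurable_hermOf

/-- The positions above the diagonal in size `m + 1`: those of the first row, and those of the
lower right block. -/
def upperSuccEquiv (m : ℕ) : Fin m ⊕ {q : Fin m × Fin m // q.1 < q.2} ≃
    {q : Fin (m + 1) × Fin (m + 1) // q.1 < q.2} :=
  Equiv.ofBijective
    (Sum.elim (fun j => ⟨(0, j.succ), Fin.succ_pos j⟩)
      fun q => ⟨(q.1.1.succ, q.1.2.succ), Fin.succ_lt_succ_iff.2 q.2⟩) <| by
    constructor
    · rintro (j | ⟨⟨i, j⟩, h⟩) (j' | ⟨⟨i', j'⟩, h'⟩) hh <;>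
        simp [Fin.ext_iff] at hh ⊢ <;> omega
    · rintro ⟨⟨i, j⟩, h⟩
      obtain ⟨j, rfl⟩ := Fin.exists_succ_eq.2 (Fin.ne_zero_of_lt h)
      induction i using Fin.cases with
      | zero => exact ⟨Sum.inl j, rfl⟩
      | succ i => exact ⟨Sum.inr ⟨(i, j), Fin.succ_lt_succ_iff.1 h⟩, rfl⟩

/-- The entries above the diagonal, from those of the first row and those of the lower right
block. -/
def upperCons {m : ℕ} (v : Fin m → 𝔽) (u : {q : Fin m × Fin m // q.1 < q.2} → 𝔽) :
    {q : Fin (m + 1) × Fin (m + 1) // q.1 < q.2} → 𝔽 :=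
  fun q => Sum.elim v u ((upperSuccEquiv m).symm q)

theorem measurePreserving_upperCons (m : ℕ) :
    MeasurePreserving (fun p : (Fin m → 𝔽) × ({q : Fin m × Fin m // q.1 < q.2} → 𝔽) =>
      upperCons p.1 p.2)
      ((Measure.pi fun _ => volume).prod (Measure.pi fun _ => volume))
      (Measure.pi fun _ => volume) := by
  have h := (measurePreserving_piCongrLeft (fun _ : {q : Fin (m + 1) × Fin (m + 1) // q.1 < q.2} =>
    (volume : Measure 𝔽)) (upperSuccEquiv m)).comp (measurePreserving_sumPiEquivProdPi_symm
      fun _ : Fin m ⊕ {q : Fin m × Fin m // q.1 < q.2} => (volume : Measure 𝔽))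
  convert h using 1
  funext p
  refine funext fun q => ?_
  obtain ⟨q, rfl⟩ := (upperSuccEquiv m).surjective q
  simp only [upperCons, Equiv.symm_apply_apply, Function.comp_apply]
  rw [MeasurableEquiv.coe_piCongrLeft, Equiv.piCongrLeft_apply_apply]
  cases q <;> rfl

theorem hermOf_cons {m : ℕ} (r : ℝ) (d : Fin m → ℝ) (v : Fin m → 𝔽)
    (u : {q : Fin m × Fin m // q.1 < q.2} → 𝔽) :
    hermOf 𝔽 (Fin.cons r d, upperCons v u) = bordered r v (hermOf 𝔽 (d, u)) := by
  have h0 : ∀ (j : Fin m) (h : (0 : Fin (m + 1)) < j.succ),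
      upperCons v u ⟨(0, j.succ), h⟩ = v j := fun j h => by
    have : (upperSuccEquiv m).symm ⟨(0, j.succ), h⟩ = Sum.inl j :=
      (Equiv.symm_apply_eq _).2 rfl
    rw [upperCons, this, Sum.elim_inl]
  have h1 : ∀ (i j : Fin m) (h : i.succ < j.succ),
      upperCons v u ⟨(i.succ, j.succ), h⟩ = u ⟨(i, j), Fin.succ_lt_succ_iff.1 h⟩ := fun i j h => by
    have : (upperSuccEquiv m).symm ⟨(i.succ, j.succ), h⟩
        = Sum.inr ⟨(i, j), Fin.succ_lt_succ_iff.1 h⟩ := (Equiv.symm_apply_eq _).2 rfl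
    rw [upperCons, this, Sum.elim_inr]
  refine Matrix.ext fun i j => ?_
  refine Fin.cases ?_ (fun i => ?_) i <;> refine Fin.cases ?_ (fun j => ?_) j
  · simp [hermOf]
  · simp [hermOf, h0]
  · simp [hermOf, h0]
  · simp [hermOf, h1]

theorem lintegral_hermVolume_succ {m : ℕ} {f : Matrix (Fin (m + 1)) (Fin (m + 1)) 𝔽 → ℝ≥0∞}
    (hf : Measurable f) :
    ∫⁻ A, f A ∂(hermVolume 𝔽 (m + 1)) = ∫⁻ r, ∫⁻ v, ∫⁻ A, f (bordered r v A)
      ∂(hermVolume 𝔽 m) ∂(Measure.pi fun _ : Fin m => (volume : Measure 𝔽)) := by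
  have hb : ∀ (r : ℝ) (v : Fin m → 𝔽), Measurable fun A => f (bordered r v A) := fun r v =>
    hf.comp (measurable_bordered measurable_const measurable_const measurable_id)
  have hg : Measurable fun p => f (hermOf 𝔽 (m := m + 1) p) := hf.comp measurable_hermOf
  rw [lintegral_hermVolume hf, lintegral_prod _ hg.aemeasurable,
    lintegral_pi_fin_succ _ hg.lintegral_prod_right']
  refine lintegral_congr fun r => ?_
  have h1 : ∀ d : Fin m → ℝ, ∫⁻ u, f (hermOf 𝔽 (Fin.cons r d, u))
      ∂(Measure.pi fun _ : {q : Fin (m + 1) × Fin (m + 1) // q.1 < q.2} => (volume : Measure 𝔽))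
      = ∫⁻ v, ∫⁻ u, f (bordered r v (hermOf 𝔽 (d, u))) ∂(Measure.pi fun _ => (volume : Measure 𝔽))
        ∂(Measure.pi fun _ => (volume : Measure 𝔽)) := fun d => by
    have hm : Measurable fun u => f (hermOf 𝔽 (Fin.cons r d, u)) :=
      hg.comp measurable_prodMk_left
    rw [← (measurePreserving_upperCons m).lintegral_comp hm, lintegral_prod]
    · simp only [hermOf_cons]
    · exact (hm.comp (measurePreserving_upperCons m).measurable).aemeasurable
  rw [lintegral_congr h1]
  have hjoint : Measurable fun p : ((Fin m → ℝ) × (Fin m → 𝔽)) ×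
      ({q : Fin m × Fin m // q.1 < q.2} → 𝔽) => f (bordered r p.1.2 (hermOf 𝔽 (p.1.1, p.2))) :=
    hf.comp (measurable_bordered measurable_const (by fun_prop)
      (measurable_hermOf.comp (by fun_prop)))
  -- The first row `v` moves outside the remaining diagonal `d`, so that `d` and `u` together form a
  -- Hermitian matrix of size `m`.
  rw [lintegral_lintegral_swap hjoint.lintegral_prod_right'.aemeasurable]
  refine lintegral_congr fun v => ?_
  rw [lintegral_hermVolume (hb r v), lintegral_prod]
  exact ((hb r v).comp measurable_hermOf).aemeasurable

theorem exists_hermOf_eq_schurTerm {m : ℕ} (r : ℝ) (v : Fin m → 𝔽) :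
    ∃ p, hermOf 𝔽 p = schurTerm r v := by
  refine ⟨(fun i => r⁻¹ * ‖v i‖ ^ 2, fun q => schurTerm r v q.1.1 q.1.2),
    Matrix.ext fun i j => ?_⟩
  simp only [hermOf, Matrix.of_apply]
  split_ifs with h h'
  · rfl
  · exact isHermitian_schurTerm r v j i
  · obtain rfl : i = j := le_antisymm (not_lt.1 h') (not_lt.1 h)
    rw [schurTerm_apply, star_mul_self', smul_smul]

theorem hermOf_add {m : ℕ} (p q : (Fin m → ℝ) × ({q : Fin m × Fin m // q.1 < q.2} → 𝔽)) :
    hermOf 𝔽 (p + q) = hermOf 𝔽 p + hermOf 𝔽 q := by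
  refine Matrix.ext fun i j => ?_
  simp only [hermOf, Matrix.of_apply, Matrix.add_apply]
  split_ifs with h h'
  · rfl
  · exact star_add' _ _
  · exact add_smul _ _ _

/-- The Schur term is Hermitian, so adding it is a translation in the coordinates of `hermOf`. This
gives Jacobian one when passing from the lower right block to the Schur complement. -/
theorem lintegral_hermVolume_add_schurTerm {m : ℕ} (r : ℝ) (v : Fin m → 𝔽)
    {f : Matrix (Fin m) (Fin m) 𝔽 → ℝ≥0∞} (hf : Measurable f) :
    ∫⁻ A, f (A + schurTerm r v) ∂(hermVolume 𝔽 m) = ∫⁻ A, f A ∂(hermVolume 𝔽 m) := by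
  obtain ⟨p, hp⟩ := exists_hermOf_eq_schurTerm r v
  have hm : Measurable fun A => f (A + schurTerm r v) :=
    hf.comp (measurable_add_matrix measurable_id measurable_const)
  rw [lintegral_hermVolume hf, lintegral_hermVolume hm, ← hp]
  simp only [← hermOf_add, add_comm _ p]
  have := FiniteDimensional.proper_real 𝔽
  have h1 : (Measure.pi fun _ : Fin m => (volume : Measure ℝ)).IsAddLeftInvariant :=
    Measure.pi.isAddLeftInvariant _
  have h2 : (Measure.pi fun _ : {q : Fin m × Fin m // q.1 < q.2} =>
      (volume : Measure 𝔽)).IsAddLeftInvariant := Measure.pi.isAddLeftInvariant _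
  exact lintegral_add_left_eq_self (fun q => f (hermOf 𝔽 q)) p

end HermVolume

end NormedDivisionAlg

end

noncomputable section
set_option linter.unusedSectionVars false

namespace NormedDivisionAlg

open scoped ENNReal RealInnerProductSpace
open Set (Ioi)

/-! ### Gram matrices: splitting off a column, and the induction -/

section Gram

variable {𝔽 : Type*} [NormedAddCommGroup 𝔽] [InnerProductSpace ℝ 𝔽] [FiniteDimensional ℝ 𝔽]
  [Mul 𝔽] [One 𝔽] [Star 𝔽] [NormedDivisionAlg 𝔽] {ι : Type*} [Fintype ι]

/-- Columns over `𝔽`, with the Euclidean norm. -/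
abbrev Col (𝔽 ι : Type*) : Type _ := PiLp 2 fun _ : ι => 𝔽

/-- The `𝔽`-valued product `xᴴ y` of two columns, as a linear map in `y`. -/
def sdot (x : Col 𝔽 ι) : Col 𝔽 ι →ₗ[ℝ] 𝔽 where
  toFun y := ∑ i, star (x i) * y i
  map_add' y z := by simp [mul_add', Finset.sum_add_distrib]
  map_smul' r y := by simp [mul_smul', Finset.smul_sum]

/-- The column `x a`, as a linear map in `a`. -/
def scale (x : Col 𝔽 ι) : 𝔽 →ₗ[ℝ] Col 𝔽 ι where
  toFun a := WithLp.toLp 2 fun i => x i * a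
  map_add' a b := PiLp.ext fun i => mul_add' (x i) a b
  map_smul' r a := PiLp.ext fun i => mul_smul' r (x i) a

theorem sdot_apply (x y : Col 𝔽 ι) : sdot x y = ∑ i, star (x i) * y i := rfl

@[simp] theorem scale_apply (x : Col 𝔽 ι) (a : 𝔽) (i : ι) : scale x a i = x i * a := rfl

theorem sdot_self (x : Col 𝔽 ι) : sdot x x = ‖x‖ ^ 2 • (1 : 𝔽) := by
  simp only [sdot_apply, star_mul_self', PiLp.norm_sq_eq_of_L2, Finset.sum_smul]

theorem star_sdot (x y : Col 𝔽 ι) : star (sdot x y) = sdot y x := by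
  simp only [sdot_apply, star_sum', star_mul', star_star']

theorem sdot_add_left (x y z : Col 𝔽 ι) : sdot (x + y) z = sdot x z + sdot y z := by
  simp [sdot_apply, star_add', add_mul', Finset.sum_add_distrib]

theorem sdot_scale (x : Col 𝔽 ι) (c : 𝔽) : sdot x (scale x c) = ‖x‖ ^ 2 • c := by
  simp only [sdot_apply, scale_apply, star_mul_self_mul, PiLp.norm_sq_eq_of_L2, Finset.sum_smul]

/-- `scale x` and `sdot x` are adjoint, so the kernel of `sdot x` is the real orthogonal complement
of the right multiples of `x`. -/
theorem inner_scale (x y : Col 𝔽 ι) (c : 𝔽) : ⟪scale x c, y⟫ = ⟪c, sdot x y⟫ := by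
  simp only [PiLp.inner_apply, scale_apply, inner_mul_left, sdot_apply, inner_sum]

theorem norm_scale (x : Col 𝔽 ι) (c : 𝔽) : ‖scale x c‖ = ‖x‖ * ‖c‖ := by
  rw [← sq_eq_sq₀ (norm_nonneg _) (by positivity), ← real_inner_self_eq_norm_sq, inner_scale,
    sdot_scale, inner_smul_right, real_inner_self_eq_norm_sq, mul_pow]

theorem sdot_scale_left_of_assoc (h : ∀ a b c : 𝔽, a * b * c = a * (b * c)) (x y : Col 𝔽 ι)
    (c : 𝔽) : sdot (scale x c) y = star c * sdot x y := by
  simp only [sdot_apply, scale_apply, star_mul', h, mul_sum']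

theorem sdot_scale_right_of_assoc (h : ∀ a b c : 𝔽, a * b * c = a * (b * c)) (x y : Col 𝔽 ι)
    (c : 𝔽) : sdot x (scale y c) = sdot x y * c := by
  simp only [sdot_apply, scale_apply, h, sum_mul']

/-- The Gram matrix of a family of columns. -/
def gram {m : ℕ} (x : Fin m → Col 𝔽 ι) : Matrix (Fin m) (Fin m) 𝔽 :=
  Matrix.of fun j k => sdot (x j) (x k)

theorem gram_cons {m : ℕ} (x : Col 𝔽 ι) (y : Fin m → Col 𝔽 ι) :
    gram (Fin.cons x y : Fin (m + 1) → Col 𝔽 ι)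
      = bordered (‖x‖ ^ 2) (fun j => sdot x (y j)) (gram y) := by
  refine Matrix.ext fun i j => ?_
  refine Fin.cases ?_ (fun i => ?_) i <;> refine Fin.cases ?_ (fun j => ?_) j
  · exact sdot_self x
  · rfl
  · exact (star_sdot _ _).symm
  · rfl

theorem schurTerm_sq_smul {m : ℕ} {s : ℝ} (hs : s ≠ 0) (c : Fin m → 𝔽) (j k : Fin m) :
    schurTerm (s ^ 2) (s • c) j k = star (c j) * c k := by
  rw [schurTerm_apply, Pi.smul_apply, Pi.smul_apply, star_smul', smul_mul',
    mul_smul', smul_smul, smul_smul, show (s ^ 2)⁻¹ * s * s = 1 by field_simp, one_smul]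

/-- With associativity the cross terms vanish by orthogonality. Otherwise there is at most one
column, the Gram matrix is its squared norm, and Pythagoras suffices. -/
theorem gram_scale_add {m : ℕ} (hm : AssocOrSmall 𝔽 (m + 1)) {x : Col 𝔽 ι} (hx : x ≠ 0)
    (c : Fin m → 𝔽) (z : Fin m → Col 𝔽 ι) (hz : ∀ j, sdot x (z j) = 0) :
    gram (fun j => scale x (‖x‖⁻¹ • c j) + z j)
      = gram z + schurTerm (‖x‖ ^ 2) (‖x‖ • c) := by
  have hn : ‖x‖ ≠ 0 := norm_ne_zero_iff.2 hx
  refine Matrix.ext fun j k => ?_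
  rw [Matrix.add_apply, schurTerm_sq_smul hn]
  change sdot _ _ = sdot _ _ + _
  rcases hm with h | h
  · have hzx : sdot (z j) x = 0 := by rw [← star_sdot, hz, star_zero']
    rw [map_add, sdot_add_left, sdot_add_left, sdot_scale_left_of_assoc h,
      sdot_scale_left_of_assoc h, hz, sdot_scale_right_of_assoc h (z j), hzx, sdot_scale, mul_zero',
      zero_mul', smul_smul, star_smul', smul_mul', mul_smul', smul_smul]
    field_simp
    simp [add_comm]
  · obtain rfl : j = k := by ext; omega
    rw [sdot_self, sdot_self, star_mul_self', ← add_smul, norm_add_sq_real, inner_scale, hz,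
      inner_zero_right, norm_scale, norm_smul, norm_inv, norm_norm, mul_inv_cancel_left₀ hn]
    congr 1
    ring

theorem sdot_scale_add {x : Col 𝔽 ι} (hx : x ≠ 0) (c : 𝔽) {z : Col 𝔽 ι} (hz : sdot x z = 0) :
    sdot x (scale x (‖x‖⁻¹ • c) + z) = ‖x‖ • c := by
  have hn : ‖x‖ ≠ 0 := norm_ne_zero_iff.2 hx
  rw [map_add, hz, add_zero, sdot_scale, smul_smul]
  congr 1
  field_simp

/-- The columns of `E` orthogonal to `x`, over `𝔽`. -/
def perp (E : Submodule ℝ (Col 𝔽 ι)) (x : Col 𝔽 ι) : Submodule ℝ (Col 𝔽 ι) :=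
  E ⊓ LinearMap.ker (sdot x)

theorem sdot_perp {E : Submodule ℝ (Col 𝔽 ι)} {x : Col 𝔽 ι} (z : perp E x) :
    sdot x (z : Col 𝔽 ι) = 0 := z.2.2

/-- `E` is closed under right multiplication by `𝔽`. -/
def IsRightClosed (E : Submodule ℝ (Col 𝔽 ι)) : Prop :=
  ∀ x ∈ E, ∀ a : 𝔽, scale x a ∈ E

/-- xᴴ(za) = (xᴴz)a. Associativity is assumed outright here; the induction calls on this only when
at least three columns are present. -/
theorem IsRightClosed.perp (h : ∀ a b c : 𝔽, a * b * c = a * (b * c))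
    {E : Submodule ℝ (Col 𝔽 ι)} (hE : IsRightClosed E) (x : Col 𝔽 ι) :
    IsRightClosed (perp E x) := fun z hz a =>
  ⟨hE z hz.1 a, by
    have h0 : sdot x z = 0 := hz.2
    change sdot x _ = 0
    rw [sdot_scale_right_of_assoc h, h0, zero_mul']⟩

/-- The orthogonal decomposition of a right closed space `E` along one of its elements. -/
def splitIsometry {E : Submodule ℝ (Col 𝔽 ι)} (hE : IsRightClosed E) {x : Col 𝔽 ι} (hx : x ∈ E)
    (hx0 : x ≠ 0) : WithLp 2 (𝔽 × perp E x) ≃ₗᵢ[ℝ] E :=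
  LinearIsometryEquiv.ofSurjective
    { toFun := fun p => ⟨scale x (‖x‖⁻¹ • p.fst) + p.snd,
        E.add_mem (hE x hx _) p.snd.2.1⟩
      map_add' := fun p q => Subtype.ext <| by
        simp only [WithLp.add_fst, WithLp.add_snd, smul_add, map_add, Submodule.coe_add]
        abel
      map_smul' := fun r p => Subtype.ext <| by
        simp only [WithLp.smul_fst, WithLp.smul_snd, map_smul, Submodule.coe_smul, smul_add,
          RingHom.id_apply, smul_comm r]
      norm_map' := fun p => by
        have hn : ‖x‖ ≠ 0 := norm_ne_zero_iff.2 hx0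
        rw [← sq_eq_sq₀ (norm_nonneg _) (norm_nonneg _), WithLp.prod_norm_sq_eq_of_L2]
        change ‖scale x (‖x‖⁻¹ • p.fst) + (p.snd : Col 𝔽 ι)‖ ^ 2 = _
        rw [norm_add_sq_real, inner_scale, sdot_perp, inner_zero_right, norm_scale, norm_smul,
          norm_inv, norm_norm, mul_inv_cancel_left₀ hn, Submodule.coe_norm]
        ring } <| by
    intro y
    have hn : ‖x‖ ≠ 0 := norm_ne_zero_iff.2 hx0
    -- The coefficient of the projection of `y` on the multiples of `x`, by `sdot_scale`.
    set a : 𝔽 := (‖x‖ ^ 2)⁻¹ • sdot x (y : Col 𝔽 ι) with ha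
    refine ⟨WithLp.toLp 2 (‖x‖ • a, ⟨(y : Col 𝔽 ι) - scale x a,
      E.sub_mem y.2 (hE x hx a), ?_⟩), Subtype.ext ?_⟩
    · change sdot x _ = 0
      rw [map_sub, sdot_scale, ha, smul_smul, mul_inv_cancel₀ (pow_ne_zero 2 hn), one_smul,
        sub_self]
    · change scale x (‖x‖⁻¹ • (‖x‖ • a)) + ((y : Col 𝔽 ι) - scale x a) = y
      rw [smul_smul, inv_mul_cancel₀ hn, one_smul, add_sub_cancel]

theorem coe_splitIsometry {E : Submodule ℝ (Col 𝔽 ι)} (hE : IsRightClosed E) {x : Col 𝔽 ι}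
    (hx : x ∈ E) (hx0 : x ≠ 0) (c : 𝔽) (z : perp E x) :
    (splitIsometry hE hx hx0 (WithLp.toLp 2 (c, z)) : Col 𝔽 ι) = scale x (‖x‖⁻¹ • c) + z := rfl

theorem finrank_perp {E : Submodule ℝ (Col 𝔽 ι)} (hE : IsRightClosed E) {x : Col 𝔽 ι}
    (hx : x ∈ E) (hx0 : x ≠ 0) :
    Module.finrank ℝ E = Module.finrank ℝ 𝔽 + Module.finrank ℝ (perp E x) := by
  rw [← (splitIsometry hE hx hx0).toLinearEquiv.finrank_eq,
    (WithLp.linearEquiv 2 ℝ (𝔽 × perp E x)).finrank_eq, Module.finrank_prod]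

variable [MeasurableSpace 𝔽] [BorelSpace 𝔽]

theorem measurable_gram {m : ℕ} : Measurable (gram : (Fin m → Col 𝔽 ι) → _) := by
  have := FiniteDimensional.proper_real 𝔽
  refine measurable_matrix_iff.2 fun j k => ?_
  simp only [gram, Matrix.of_apply, sdot_apply]
  exact Finset.measurable_fun_sum _ fun i _ => measurable_mul'
    (measurable_star'.comp (by fun_prop)) (by fun_prop)

theorem measurable_gram_coe {m : ℕ} {E : Submodule ℝ (Col 𝔽 ι)} :
    Measurable fun x : Fin m → E => gram fun j => (x j : Col 𝔽 ι) :=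
  measurable_gram.comp (measurable_pi_iff.2 fun j =>
    measurable_subtype_coe.comp (measurable_pi_apply j))

theorem measurePreserving_split {E : Submodule ℝ (Col 𝔽 ι)} (hE : IsRightClosed E) {x : Col 𝔽 ι}
    (hx : x ∈ E) (hx0 : x ≠ 0) (m : ℕ) :
    MeasurePreserving (fun (p : (Fin m → 𝔽) × (Fin m → perp E x)) (j : Fin m) =>
        splitIsometry hE hx hx0 (WithLp.toLp 2 (p.1 j, p.2 j)))
      ((Measure.pi fun _ => volume).prod (Measure.pi fun _ => volume))
      (Measure.pi fun _ => volume) := by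
  have := FiniteDimensional.proper_real 𝔽
  exact (measurePreserving_pi (fun _ : Fin m => (volume : Measure (𝔽 × perp E x)))
    (fun _ => volume) fun _ =>
      (splitIsometry hE hx hx0).measurePreserving.comp (WithLp.volume_preserving_toLp _ _)).comp
    (measurePreserving_arrowProdEquivProdArrow 𝔽 (perp E x) (Fin m)
      (fun _ => volume) (fun _ => volume)).symm

/-- Scaling in real dimension `βm`. The factor is written in `s ^ 2` because with `s = ‖x‖` this is
the corner of the Gram matrix. -/
theorem lintegral_comp_smul_pi {m : ℕ} {s : ℝ} (hs : 0 < s) (G : (Fin m → 𝔽) → ℝ≥0∞)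
    (hG : Measurable G) :
    ∫⁻ c, G (s • c) ∂(Measure.pi fun _ : Fin m => (volume : Measure 𝔽))
      = ENNReal.ofReal ((s ^ 2) ^ (-(beta 𝔽 * m / 2)))
        * ∫⁻ v, G v ∂(Measure.pi fun _ : Fin m => (volume : Measure 𝔽)) := by
  have := FiniteDimensional.proper_real 𝔽
  have hH : (Measure.pi fun _ : Fin m => (volume : Measure 𝔽)).IsAddHaarMeasure :=
    Measure.pi.isAddHaarMeasure _
  have h := Measure.map_addHaar_smul (Measure.pi fun _ : Fin m => (volume : Measure 𝔽)) hs.ne'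
  rw [← lintegral_map (f := G) hG (measurable_const_smul s), h, lintegral_smul_measure, smul_eq_mul]
  congr 2
  rw [Module.finrank_pi_fintype, Finset.sum_const, Finset.card_univ, Fintype.card_fin, smul_eq_mul,
    abs_of_pos (by positivity), ← Real.rpow_natCast, ← Real.rpow_neg hs.le, ← Real.rpow_natCast s 2,
    ← Real.rpow_mul hs.le]
  congr 1
  rw [beta]
  push_cast
  ring

/-- The integral of `f (gram x)` over families of `m` elements of `E` is, up to the constant `k`,
the integral of `f` over the cone against a power of the determinant. -/
def GramFormula (E : Submodule ℝ (Col 𝔽 ι)) (m : ℕ) (e : ℝ) (k : ℝ≥0∞) : Prop :=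
  ∀ f : Matrix (Fin m) (Fin m) 𝔽 → ℝ≥0∞, Measurable f →
    ∫⁻ x : Fin m → E, f (gram fun j => (x j : Col 𝔽 ι)) ∂(Measure.pi fun _ => volume)
      = k * ∫⁻ A in posDefCone 𝔽 m, ENNReal.ofReal (hdet A ^ e) * f A ∂(hermVolume 𝔽 m)

/-- The formula for `f (gram x)` with fixed nonzero first column. -/
def FiberGramFormula (E : Submodule ℝ (Col 𝔽 ι)) (m : ℕ) (e : ℝ) (k : ℝ≥0∞) : Prop :=
  ∀ x ∈ E, x ≠ 0 → ∀ f : Matrix (Fin (m + 1)) (Fin (m + 1)) 𝔽 → ℝ≥0∞, Measurable f →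
    ∫⁻ y : Fin m → E, f (gram (Fin.cons x fun j => (y j : Col 𝔽 ι) : Fin (m + 1) → Col 𝔽 ι))
        ∂(Measure.pi fun _ => volume)
      = k * (ENNReal.ofReal ((‖x‖ ^ 2) ^ (-(beta 𝔽 * m / 2))) * ∫⁻ v, ∫⁻ W in posDefCone 𝔽 m,
          ENNReal.ofReal (hdet W ^ e)
            * f (bordered (‖x‖ ^ 2) v (W + schurTerm (‖x‖ ^ 2) v)) ∂(hermVolume 𝔽 m)
          ∂(Measure.pi fun _ : Fin m => (volume : Measure 𝔽)))

theorem measurable_fiber_integrand {m : ℕ} (e : ℝ)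
    {f : Matrix (Fin (m + 1)) (Fin (m + 1)) 𝔽 → ℝ≥0∞} (hf : Measurable f) :
    Measurable fun p : (ℝ × (Fin m → 𝔽)) × Matrix (Fin m) (Fin m) 𝔽 =>
      ENNReal.ofReal (hdet p.2 ^ e)
        * f (bordered p.1.1 p.1.2 (p.2 + schurTerm p.1.1 p.1.2)) :=
  ((measurable_hdet.comp measurable_snd).pow_const e).ennreal_ofReal.mul
    (hf.comp (measurable_bordered (by fun_prop) (by fun_prop)
      (measurable_add_matrix measurable_snd (measurable_schurTerm (by fun_prop) (by fun_prop)))))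

theorem lintegral_posDefCone_zero (e : ℝ)
    (F : (Fin 0 → 𝔽) → Matrix (Fin 0) (Fin 0) 𝔽 → ℝ≥0∞) {c : ℝ≥0∞} (hF : ∀ v W, F v W = c) :
    ∫⁻ v, ∫⁻ W in posDefCone 𝔽 0, ENNReal.ofReal (hdet W ^ e) * F v W ∂(hermVolume 𝔽 0)
      ∂(Measure.pi fun _ : Fin 0 => (volume : Measure 𝔽)) = c := by
  have hcone : posDefCone 𝔽 0 = Set.univ := Set.eq_univ_of_forall fun A =>
    ⟨Subsingleton.elim _ _, fun v hv => absurd (Subsingleton.elim v 0) hv⟩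
  have hdet1 : ∀ W : Matrix (Fin 0) (Fin 0) 𝔽, hdet W = 1 := fun W => by
    rw [hdet, LinearMap.det_eq_one_of_subsingleton, Real.one_rpow]
  have hvol : hermVolume 𝔽 0 Set.univ = 1 := by
    rw [hermVolume, Measure.map_apply measurable_hermOf MeasurableSet.univ]
    have : IsEmpty {q : Fin 0 × Fin 0 // q.1 < q.2} := ⟨fun q => q.1.1.elim0⟩
    rw [Set.preimage_univ, ← Set.univ_prod_univ, Measure.prod_prod]
    simp
  simp only [hdet1, hF, Real.one_rpow, hcone, lintegral_const, Measure.restrict_univ, hvol]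
  simp

theorem fiberGramFormula_zero (E : Submodule ℝ (Col 𝔽 ι)) (e : ℝ) : FiberGramFormula E 0 e 1 := by
  intro x hx hx0 f hf
  have y₀ : Fin 0 → E := fun _ => 0
  have hy : ∀ y : Fin 0 → E, f (gram (Fin.cons x fun j => (y j : Col 𝔽 ι) : Fin (0 + 1) → Col 𝔽 ι))
      = f (gram (Fin.cons x fun j => (y₀ j : Col 𝔽 ι) : Fin (0 + 1) → Col 𝔽 ι)) := fun y => by
    rw [Subsingleton.elim y y₀]
  rw [lintegral_posDefCone_zero e _ fun v W => congrArg f <| show bordered (‖x‖ ^ 2) v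
    (W + schurTerm (‖x‖ ^ 2) v)
      = gram (Fin.cons x fun j => (y₀ j : Col 𝔽 ι) : Fin (0 + 1) → Col 𝔽 ι) by
    rw [gram_cons]
    congr 1 <;> exact Subsingleton.elim _ _]
  simp only [hy, lintegral_const]
  simp

/-- Split every remaining column along `x`: the components along `x` become the first row after
scaling by `‖x‖`, and the formula on `perp E x` handles the Schur complement. -/
theorem GramFormula.fiber {m : ℕ} (hm : AssocOrSmall 𝔽 (m + 1)) {E : Submodule ℝ (Col 𝔽 ι)}
    (hE : IsRightClosed E) {e : ℝ} {k : ℝ≥0∞}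
    (h : ∀ x ∈ E, x ≠ 0 → GramFormula (perp E x) m e k) : FiberGramFormula E m e k := by
  have := FiniteDimensional.proper_real 𝔽
  intro x hx hx0 f hf
  have hn : 0 < ‖x‖ := norm_pos_iff.2 hx0
  have hmeas := measurable_fiber_integrand e hf
  have hG : Measurable fun v : Fin m → 𝔽 => ∫⁻ W in posDefCone 𝔽 m, ENNReal.ofReal (hdet W ^ e)
      * f (bordered (‖x‖ ^ 2) v (W + schurTerm (‖x‖ ^ 2) v)) ∂(hermVolume 𝔽 m) :=
    hmeas.lintegral_prod_right'.comp measurable_prodMk_left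
  have hGs : Measurable fun c : Fin m → 𝔽 => ∫⁻ W in posDefCone 𝔽 m, ENNReal.ofReal (hdet W ^ e)
      * f (bordered (‖x‖ ^ 2) (‖x‖ • c) (W + schurTerm (‖x‖ ^ 2) (‖x‖ • c))) ∂(hermVolume 𝔽 m) :=
    hG.comp (measurable_const_smul ‖x‖)
  rw [← lintegral_comp_smul_pi hn _ hG, ← lintegral_const_mul _ hGs]
  have hF : Measurable fun y : Fin m → E =>
      f (gram (Fin.cons x fun j => (y j : Col 𝔽 ι) : Fin (m + 1) → Col 𝔽 ι)) := by
    refine hf.comp (measurable_gram.comp (measurable_pi_iff.2 fun j => ?_))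
    refine Fin.cases ?_ (fun j => ?_) j
    · exact measurable_const
    · exact measurable_subtype_coe.comp (measurable_pi_apply j)
  have hmp := measurePreserving_split hE hx hx0 m
  rw [← hmp.lintegral_comp hF, lintegral_prod]
  swap
  · exact (hF.comp hmp.measurable).aemeasurable
  refine lintegral_congr fun c => ?_
  have key := h x hx hx0 (fun A => f (bordered (‖x‖ ^ 2) (‖x‖ • c)
    (A + schurTerm (‖x‖ ^ 2) (‖x‖ • c)))) (hf.comp (measurable_bordered measurable_const
      measurable_const (measurable_add_matrix measurable_id measurable_const)))
  rw [← key]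
  refine lintegral_congr fun z => ?_
  rw [gram_cons]
  simp only [coe_splitIsometry]
  rw [gram_scale_add hm hx0 c (fun j => (z j : Col 𝔽 ι)) fun j => sdot_perp (z j)]
  congr 2
  exact funext fun j => sdot_scale_add hx0 (c j) (sdot_perp (z j))

theorem lintegral_indicator_bordered {m : ℕ} (hm : AssocOrSmall 𝔽 (m + 1)) (e : ℝ)
    {f : Matrix (Fin (m + 1)) (Fin (m + 1)) 𝔽 → ℝ≥0∞} (hf : Measurable f) {r : ℝ} (hr : 0 < r)
    (v : Fin m → 𝔽) :
    ∫⁻ A, (posDefCone 𝔽 (m + 1)).indicator (fun A => ENNReal.ofReal (hdet A ^ e) * f A)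
        (bordered r v A) ∂(hermVolume 𝔽 m)
      = ENNReal.ofReal (r ^ e) * ∫⁻ W in posDefCone 𝔽 m, ENNReal.ofReal (hdet W ^ e)
          * f (bordered r v (W + schurTerm r v)) ∂(hermVolume 𝔽 m) := by
  have hg : Measurable fun A : Matrix (Fin (m + 1)) (Fin (m + 1)) 𝔽 =>
      ENNReal.ofReal (hdet A ^ e) * f A :=
    (measurable_hdet.pow_const e).ennreal_ofReal.mul hf
  have hgb : Measurable fun A : Matrix (Fin m) (Fin m) 𝔽 =>
      (posDefCone 𝔽 (m + 1)).indicator (fun A => ENNReal.ofReal (hdet A ^ e) * f A)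
        (bordered r v A) :=
    (hg.indicator (measurableSet_posDefCone hm)).comp
      (measurable_bordered measurable_const measurable_const measurable_id)
  have hfW : Measurable fun W => ENNReal.ofReal (hdet W ^ e)
      * f (bordered r v (W + schurTerm r v)) :=
    (measurable_hdet.pow_const e).ennreal_ofReal.mul (hf.comp (measurable_bordered measurable_const
      measurable_const (measurable_add_matrix measurable_id measurable_const)))
  rw [← lintegral_const_mul _ hfW, ← lintegral_indicator (measurableSet_posDefCone hm.pred)]
  -- Changes variables from the lower right block to the Schur complement `W`, in which cone
  -- membership and determinant both decouple.
  have htrans := lintegral_hermVolume_add_schurTerm r v hgb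
  rw [← htrans]
  refine lintegral_congr fun W => ?_
  have hiff : bordered r v (W + schurTerm r v) ∈ posDefCone 𝔽 (m + 1)
      ↔ W ∈ posDefCone 𝔽 m := by
    rw [bordered_mem_posDefCone_iff hm, add_sub_cancel_right, and_iff_right hr]
  by_cases hW : W ∈ posDefCone 𝔽 m
  · rw [Set.indicator_of_mem (hiff.2 hW), Set.indicator_of_mem hW,
      hdet_bordered hm hr (by rwa [add_sub_cancel_right]), add_sub_cancel_right,
      Real.mul_rpow hr.le (hdet_pos hm.pred hW).le, ENNReal.ofReal_mul (by positivity),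
      mul_assoc]
  · rw [Set.indicator_of_notMem (mt hiff.1 hW), Set.indicator_of_notMem hW]

theorem setLIntegral_posDefCone_succ {m : ℕ} (hm : AssocOrSmall 𝔽 (m + 1)) (e : ℝ)
    {f : Matrix (Fin (m + 1)) (Fin (m + 1)) 𝔽 → ℝ≥0∞} (hf : Measurable f) :
    ∫⁻ A in posDefCone 𝔽 (m + 1), ENNReal.ofReal (hdet A ^ e) * f A ∂(hermVolume 𝔽 (m + 1))
      = ∫⁻ r in Ioi (0 : ℝ), ENNReal.ofReal (r ^ e) * ∫⁻ v, ∫⁻ W in posDefCone 𝔽 m,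
          ENNReal.ofReal (hdet W ^ e) * f (bordered r v (W + schurTerm r v)) ∂(hermVolume 𝔽 m)
          ∂(Measure.pi fun _ : Fin m => (volume : Measure 𝔽)) := by
  have hg : Measurable fun A : Matrix (Fin (m + 1)) (Fin (m + 1)) 𝔽 =>
      ENNReal.ofReal (hdet A ^ e) * f A :=
    (measurable_hdet.pow_const e).ennreal_ofReal.mul hf
  rw [← lintegral_indicator (measurableSet_posDefCone hm),
    lintegral_hermVolume_succ (hg.indicator (measurableSet_posDefCone hm)),
    ← lintegral_indicator measurableSet_Ioi]
  refine lintegral_congr fun r => ?_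
  by_cases hr : 0 < r
  · have hΦr : Measurable fun v : Fin m → 𝔽 => ∫⁻ W in posDefCone 𝔽 m,
        ENNReal.ofReal (hdet W ^ e) * f (bordered r v (W + schurTerm r v)) ∂(hermVolume 𝔽 m) :=
      (measurable_fiber_integrand e hf).lintegral_prod_right'.comp measurable_prodMk_left
    rw [Set.indicator_of_mem (Set.mem_Ioi.2 hr), ← lintegral_const_mul _ hΦr]
    exact lintegral_congr fun v => lintegral_indicator_bordered hm e hf hr v
  · rw [Set.indicator_of_notMem (by simpa using hr)]
    have h0 : ∀ v A, (posDefCone 𝔽 (m + 1)).indicator (fun A => ENNReal.ofReal (hdet A ^ e) * f A)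
        (bordered r v A) = 0 := fun v A =>
      Set.indicator_of_notMem (fun hmem => hr ((bordered_mem_posDefCone_iff hm).1 hmem).1) _
    simp only [h0, lintegral_zero]

/-- Integrates the fibre formula over the first column in polar coordinates, then recognises the
cone in its bordered coordinates. -/
theorem FiberGramFormula.gramFormula {m N : ℕ} (hm : AssocOrSmall 𝔽 (m + 1)) {K k : ℝ≥0∞}
    {E : Submodule ℝ (Col 𝔽 ι)} (hE : Module.finrank ℝ E = N * Module.finrank ℝ 𝔽) (hN : 0 < N)
    (hK : ∀ {Ψ : ℝ → ℝ≥0∞}, Measurable Ψ → ∫⁻ x : E, Ψ (‖x‖ ^ 2) = K * ∫⁻ s in Ioi (0 : ℝ),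
      ENNReal.ofReal (s ^ (((N * Module.finrank ℝ 𝔽 : ℕ) : ℝ) / 2 - 1)) * Ψ s)
    (h : FiberGramFormula E m (beta 𝔽 * ((N : ℝ) - m) / 2 - 1) k) :
    GramFormula E (m + 1) (beta 𝔽 * ((N : ℝ) - m) / 2 - 1) (K * k) := by
  have := FiniteDimensional.proper_real 𝔽
  intro f hf
  set e := beta 𝔽 * ((N : ℝ) - m) / 2 - 1 with he
  have hnt : Nontrivial E := Module.finrank_pos_iff (R := ℝ).1 <| by
    rw [hE]; exact Nat.mul_pos hN (finrank_pos' 𝔽)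
  set Φ : ℝ → ℝ≥0∞ := fun r => ∫⁻ v, ∫⁻ W in posDefCone 𝔽 m, ENNReal.ofReal (hdet W ^ e)
    * f (bordered r v (W + schurTerm r v)) ∂(hermVolume 𝔽 m)
    ∂(Measure.pi fun _ : Fin m => (volume : Measure 𝔽))
  have hΦm : Measurable Φ :=
    (measurable_fiber_integrand e hf).lintegral_prod_right'.lintegral_prod_right'
  have hL : ∫⁻ x : Fin (m + 1) → E, f (gram fun j => (x j : Col 𝔽 ι))
      ∂(Measure.pi fun _ => volume)
      = K * (k * ∫⁻ r in Ioi (0 : ℝ), ENNReal.ofReal (r ^ e) * Φ r) := by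
    have hfg : Measurable fun x : Fin (m + 1) → E => f (gram fun j => (x j : Col 𝔽 ι)) :=
      hf.comp measurable_gram_coe
    rw [lintegral_pi_fin_succ _ hfg]
    have hae : ∀ᵐ x : E, ∫⁻ y : Fin m → E,
        f (gram fun j => ((Fin.cons x y : Fin (m + 1) → E) j : Col 𝔽 ι))
          ∂(Measure.pi fun _ => volume)
        = k * (ENNReal.ofReal ((‖x‖ ^ 2) ^ (-(beta 𝔽 * m / 2))) * Φ (‖x‖ ^ 2)) := by
      -- `E` has positive dimension, so the origin, where the splitting fails, is negligible.
      have h0 : ∀ᵐ x : E, x ≠ 0 := compl_mem_ae_iff.2 (measure_singleton 0)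
      filter_upwards [h0] with x hx
      have h' := h x x.2 (by simpa using hx) f hf
      refine Eq.trans ?_ h'
      refine lintegral_congr fun y => ?_
      congr 2
      refine funext fun j => Fin.cases ?_ (fun j => ?_) j <;> rfl
    rw [lintegral_congr_ae hae, hK (Ψ := fun r => k * (ENNReal.ofReal (r ^ (-(beta 𝔽 * m / 2)))
      * Φ r)) (by fun_prop)]
    congr 1
    rw [← lintegral_const_mul _ (by fun_prop)]
    refine setLIntegral_congr_fun measurableSet_Ioi fun r hr => ?_
    have hr' : 0 < r := hr
    -- The radial and scaling powers combine into the exponent already carried by `W`, which makes a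
    -- single power of the full determinant.
    have hpow : r ^ (((N * Module.finrank ℝ 𝔽 : ℕ) : ℝ) / 2 - 1) * r ^ (-(beta 𝔽 * m / 2))
        = r ^ e := by
      rw [← Real.rpow_add hr', he, beta]
      congr 1
      push_cast
      ring
    rw [← hpow, ENNReal.ofReal_mul (by positivity)]
    ring
  rw [hL, setLIntegral_posDefCone_succ hm e hf, mul_assoc]

/-- `k` depends on `E` only through its dimension, as integration over the first column requires. A
single column needs only the norm, so right closure is asked for from two columns on. -/
theorem exists_gramFormula (𝔽 : Type*) [NormedAddCommGroup 𝔽] [InnerProductSpace ℝ 𝔽]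
    [FiniteDimensional ℝ 𝔽] [Mul 𝔽] [One 𝔽] [Star 𝔽] [NormedDivisionAlg 𝔽] [MeasurableSpace 𝔽]
    [BorelSpace 𝔽] (ι : Type*) [Fintype ι] {m N : ℕ} (hm : AssocOrSmall 𝔽 (m + 1))
    (hN : m + 1 ≤ N) :
    ∃ k : ℝ≥0∞, ∀ E : Submodule ℝ (Col 𝔽 ι),
      Module.finrank ℝ E = N * Module.finrank ℝ 𝔽 → (1 ≤ m → IsRightClosed E) →
      GramFormula E (m + 1) (beta 𝔽 * ((N : ℝ) - m) / 2 - 1) k := by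
  induction m generalizing N with
  | zero =>
    obtain ⟨K, hK⟩ := exists_lintegral_norm_sq (Nat.mul_pos hN (finrank_pos' 𝔽))
    exact ⟨K * 1, fun E hE _ =>
      FiberGramFormula.gramFormula hm hE hN (hK hE) (fiberGramFormula_zero E _)⟩
  | succ m ih =>
    obtain ⟨N, rfl⟩ : ∃ N', N = N' + 1 := ⟨N - 1, by omega⟩
    obtain ⟨k, hk⟩ := ih hm.pred (N := N) (by omega)
    obtain ⟨K, hK⟩ := exists_lintegral_norm_sq
      (Nat.mul_pos N.succ_pos (finrank_pos' 𝔽))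
    refine ⟨K * k, fun E hE hcl => ?_⟩
    refine FiberGramFormula.gramFormula hm hE N.succ_pos (hK hE) ?_
    -- Removing a column lowers both numbers by one and leaves the exponent unchanged.
    have hexp : beta 𝔽 * (((N + 1 : ℕ) : ℝ) - ((m + 1 : ℕ) : ℝ)) / 2 - 1
        = beta 𝔽 * ((N : ℝ) - m) / 2 - 1 := by push_cast; ring
    rw [hexp]
    refine GramFormula.fiber hm (hcl (by omega)) fun x hx hx0 => hk _ ?_ fun h1 => ?_
    · have := finrank_perp (hcl (by omega)) hx hx0
      rw [hE, add_mul, one_mul, add_comm] at this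
      exact (Nat.add_left_cancel this).symm
    -- Closure of `perp E x` matters only if two columns remain, hence three in all, which rules out
    -- the nonassociative alternative.
    · rcases hm with hm | hm
      · exact (hcl (by omega)).perp hm x
      · omega

end Gram

end NormedDivisionAlg

end

noncomputable section
set_option linter.unusedSectionVars false

open scoped ENNReal RealInnerProductSpace
open Set (Ioi)

/-! ### Rearranging product measures, and normalising constants -/

section ProductMeasures

theorem measurePreserving_sigmaUncurry {ι : Type*} [Fintype ι] {κ : ι → Type*}
    [∀ i, Fintype (κ i)] {α : Type*} [MeasurableSpace α] (μ : Measure α) [SigmaFinite μ] :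
    MeasurePreserving (MeasurableEquiv.piCurry fun (i : ι) (_ : κ i) => α).symm
      (Measure.pi fun i => Measure.pi fun _ : κ i => μ) (Measure.pi fun _ => μ) where
  measurable := MeasurableEquiv.measurable _
  map_eq := by
    refine (Measure.pi_eq fun s _ => ?_).symm
    rw [MeasurableEquiv.map_apply]
    have : (MeasurableEquiv.piCurry fun (i : ι) (_ : κ i) => α).symm ⁻¹' Set.univ.pi s
        = Set.univ.pi fun i => Set.univ.pi fun j => s ⟨i, j⟩ := by
      ext y
      simp [MeasurableEquiv.coe_piCurry_symm, Sigma.uncurry, Set.mem_pi, Sigma.forall]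
    rw [this, Measure.pi_pi]
    simp only [Measure.pi_pi, Fintype.prod_sigma]

theorem measurePreserving_transpose {ι κ : Type*} [Fintype ι] [Fintype κ] {α : Type*}
    [MeasurableSpace α] (μ : Measure α) [SigmaFinite μ] :
    MeasurePreserving (fun (Y : ι → κ → α) (j : κ) (i : ι) => Y i j)
      (Measure.pi fun _ => Measure.pi fun _ => μ) (Measure.pi fun _ => Measure.pi fun _ => μ) := by
  let e : (Σ _ : ι, κ) ≃ (Σ _ : κ, ι) :=
    ⟨fun p => ⟨p.2, p.1⟩, fun p => ⟨p.2, p.1⟩, fun _ => rfl, fun _ => rfl⟩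
  have h := ((measurePreserving_sigmaUncurry (ι := κ) (κ := fun _ => ι) μ).symm).comp
    ((measurePreserving_piCongrLeft (fun _ : (Σ _ : κ, ι) => μ) e).comp
      (measurePreserving_sigmaUncurry (ι := ι) (κ := fun _ => κ) μ))
  convert h using 1
  funext Y j i
  refine Eq.symm ?_
  change MeasurableEquiv.piCongrLeft (fun _ => α) e (Sigma.uncurry Y) (e ⟨i, j⟩) = Y i j
  rw [MeasurableEquiv.coe_piCongrLeft, Equiv.piCongrLeft_apply_apply]
  rfl

/-- Orthonormal bases of the factors concatenate to one of the product, reducing the claim to real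
coordinates. -/
theorem PiLp.volume_preserving_toLp_of_innerProductSpace (ι : Type*) [Fintype ι] (E : Type*)
    [NormedAddCommGroup E] [InnerProductSpace ℝ E] [FiniteDimensional ℝ E] [MeasurableSpace E]
    [BorelSpace E] :
    MeasurePreserving (WithLp.toLp 2 : (ι → E) → PiLp 2 fun _ : ι => E)
      (Measure.pi fun _ => volume) volume := by
  have := FiniteDimensional.proper_real E
  let b := stdOrthonormalBasis ℝ E
  let B := Pi.orthonormalBasis fun _ : ι => b
  have h1 : MeasurePreserving (fun (x : ι → E) (i : ι) => WithLp.ofLp (b.repr (x i)))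
      (Measure.pi fun _ => volume) (Measure.pi fun _ => Measure.pi fun _ => volume) :=
    measurePreserving_pi _ _ fun _ =>
      (PiLp.volume_preserving_ofLp _).comp b.measurePreserving_repr
  have h := B.measurePreserving_repr_symm.comp ((PiLp.volume_preserving_toLp _).comp
    ((measurePreserving_sigmaUncurry volume).comp h1))
  convert h using 1
  funext x
  rw [Function.comp_apply, LinearIsometryEquiv.eq_symm_apply]
  rfl

theorem map_withDensity_comp {α β : Type*} [MeasurableSpace α] [MeasurableSpace β]
    (μ : Measure α) {T : α → β} (hT : Measurable T) {g : β → ℝ≥0∞} (hg : Measurable g) :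
    (μ.withDensity fun x => g (T x)).map T = (μ.map T).withDensity g := by
  refine Measure.ext fun s hs => ?_
  rw [Measure.map_apply hT hs, withDensity_apply _ (hT hs), withDensity_apply _ hs,
    setLIntegral_map hs hg hT]

/-- Identifies the unknown constant from one test integral. Finiteness of `G`, the convergence of
the Gamma integral, comes out as a by-product. -/
theorem ENNReal.eq_ofReal_div_toReal {k G : ℝ≥0∞} {p : ℝ} (hp : 0 < p)
    (h : k * G = ENNReal.ofReal p) : 0 < G.toReal ∧ k = ENNReal.ofReal (p / G.toReal) := by
  have hp' : ENNReal.ofReal p ≠ 0 := by simpa using hp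
  have hk0 : k ≠ 0 := fun h0 => hp' (by rw [← h, h0, zero_mul])
  have hG0 : G ≠ 0 := fun h0 => hp' (by rw [← h, h0, mul_zero])
  have hGT : G ≠ ∞ := fun h0 => by
    rw [h0, ENNReal.mul_top hk0] at h
    exact ENNReal.ofReal_ne_top h.symm
  have hpos := ENNReal.toReal_pos hG0 hGT
  refine ⟨hpos, ?_⟩
  rw [ENNReal.ofReal_div_of_pos hpos, ENNReal.ofReal_toReal hGT, ← h,
    ENNReal.mul_div_cancel_right hG0 hGT]

end ProductMeasures

namespace NormedDivisionAlg

variable {𝔽 : Type*} [NormedAddCommGroup 𝔽] [InnerProductSpace ℝ 𝔽] [FiniteDimensional ℝ 𝔽]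
  [Mul 𝔽] [One 𝔽] [Star 𝔽] [NormedDivisionAlg 𝔽]

/-! ### The real trace -/

section Trace

theorem conjTranspose_mul_self_apply {ι κ : Type*} [Fintype ι] (Y : Matrix ι κ 𝔽) (j k : κ) :
    (Yᴴ * Y) j k = ∑ i, star (Y i j) * Y i k := rfl

theorem retr_conjTranspose_mul_self {ι κ : Type*} [Fintype ι] [Fintype κ] (Y : Matrix ι κ 𝔽) :
    retr (Yᴴ * Y) = ∑ i, ∑ j, ‖Y i j‖ ^ 2 := by
  rw [Finset.sum_comm]
  simp only [retr, Matrix.trace, Matrix.diag_apply, conjTranspose_mul_self_apply, re_sum,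
    re_star_mul, real_inner_self_eq_norm_sq]

theorem retr_add {m : ℕ} (A B : Matrix (Fin m) (Fin m) 𝔽) : retr (A + B) = retr A + retr B := by
  rw [retr, Matrix.trace_add, re_add, retr, retr]

theorem retr_sum {m : ℕ} {ι : Type*} (s : Finset ι) (A : ι → Matrix (Fin m) (Fin m) 𝔽) :
    retr (∑ i ∈ s, A i) = ∑ i ∈ s, retr (A i) := by
  rw [retr, Matrix.trace_sum, re_sum]; rfl

theorem retr_bordered {m : ℕ} (r : ℝ) (v : Fin m → 𝔽) (A : Matrix (Fin m) (Fin m) 𝔽) :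
    retr (bordered r v A) = r + retr A := by
  simp only [retr, Matrix.trace, Matrix.diag_apply, Fin.sum_univ_succ, re_add, re_sum,
    bordered_zero_zero, bordered_succ_succ, re_smul_one]

theorem retr_nonneg {m : ℕ} {A : Matrix (Fin m) (Fin m) 𝔽} (hA : A ∈ posDefCone 𝔽 m) :
    0 ≤ retr A := by
  simp only [retr, Matrix.trace, Matrix.diag_apply, re_sum]
  refine Finset.sum_nonneg fun i _ => ?_
  have h := (mem_posDefCone_iff.1 hA).2 (Pi.single i 1) (by simpa using one_ne_zero' (𝔽 := 𝔽))
  have hq : quadForm A (Pi.single i 1) = re (A i i) := by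
    rw [quadForm_eq, Finset.sum_eq_single i, Pi.single_eq_same, mulVecLin_apply,
      Finset.sum_eq_single i, Pi.single_eq_same, mul_one', re]
    · intro j _ hj; rw [Pi.single_eq_of_ne hj, mul_zero']
    · simp
    · intro j _ hj; rw [Pi.single_eq_of_ne hj, inner_zero_left]
    · simp
  exact (hq ▸ h).le

end Trace

variable [MeasurableSpace 𝔽] [BorelSpace 𝔽]

theorem measurable_retr {m : ℕ} :
    Measurable (retr : Matrix (Fin m) (Fin m) 𝔽 → ℝ) := by
  have h : (retr : Matrix (Fin m) (Fin m) 𝔽 → ℝ) = fun A => ∑ i, re (A i i) := by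
    funext A
    simp only [retr, Matrix.trace, Matrix.diag_apply, re_sum]
  rw [h]
  exact Finset.measurable_fun_sum _ fun i _ => measurable_re.comp (measurable_matrix_apply i i)

theorem measurable_conjTranspose_mul_self {ι : Type*} [Fintype ι] {m : ℕ} :
    Measurable fun Y : Matrix ι (Fin m) 𝔽 => Yᴴ * Y := by
  have := FiniteDimensional.proper_real 𝔽
  refine measurable_matrix_iff.2 fun j k => ?_
  simp only [conjTranspose_mul_self_apply]
  exact Finset.measurable_fun_sum _ fun i _ => measurable_mul'
    (measurable_star'.comp (measurable_matrix_apply i j)) (measurable_matrix_apply i k)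

/-! ### Images of Lebesgue measure under the trace and the Gram matrix -/

section MatVolume

variable (𝔽) (ι κ : Type*) [Fintype ι] [Fintype κ]

instance : SigmaFinite (matVolume 𝔽 ι κ) :=
  have := FiniteDimensional.proper_real 𝔽
  inferInstanceAs (SigmaFinite (Measure.pi fun _ : ι => Measure.pi fun _ : κ =>
    (volume : Measure 𝔽)))

theorem measurePreserving_matVolume_columns :
    MeasurePreserving (fun (Y : Matrix ι κ 𝔽) (j : κ) => (WithLp.toLp 2 fun i => Y i j : Col 𝔽 ι))
      (matVolume 𝔽 ι κ) (Measure.pi fun _ => volume) :=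
  have := FiniteDimensional.proper_real 𝔽
  (measurePreserving_pi (fun _ : κ => Measure.pi fun _ : ι => (volume : Measure 𝔽))
    (fun _ => volume) fun _ => PiLp.volume_preserving_toLp_of_innerProductSpace ι 𝔽).comp
      (measurePreserving_transpose volume)

theorem measurePreserving_matVolume_toLp :
    MeasurePreserving (fun Y : Matrix ι κ 𝔽 =>
      (WithLp.toLp 2 fun j => WithLp.toLp 2 fun i => Y i j : PiLp 2 fun _ : κ => Col 𝔽 ι))
      (matVolume 𝔽 ι κ) volume :=
  (PiLp.volume_preserving_toLp_of_innerProductSpace κ (Col 𝔽 ι)).comp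
    (measurePreserving_matVolume_columns 𝔽 ι κ)

theorem finrank_col : Module.finrank ℝ (Col 𝔽 ι) = Fintype.card ι * Module.finrank ℝ 𝔽 := by
  rw [(WithLp.linearEquiv 2 ℝ (ι → 𝔽)).finrank_eq, Module.finrank_pi_fintype, Finset.sum_const,
    Finset.card_univ, smul_eq_mul]

theorem finrank_col_col : Module.finrank ℝ (PiLp 2 fun _ : κ => Col 𝔽 ι)
    = Fintype.card κ * (Fintype.card ι * Module.finrank ℝ 𝔽) := by
  rw [(WithLp.linearEquiv 2 ℝ (κ → Col 𝔽 ι)).finrank_eq, Module.finrank_pi_fintype,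
    Finset.sum_const, Finset.card_univ, smul_eq_mul, finrank_col]

variable {ι κ}

theorem norm_sq_toLp_toLp (Y : Matrix ι κ 𝔽) :
    ‖(WithLp.toLp 2 fun j => WithLp.toLp 2 fun i => Y i j : PiLp 2 fun _ : κ => Col 𝔽 ι)‖ ^ 2
      = retr (Yᴴ * Y) := by
  rw [retr_conjTranspose_mul_self, PiLp.norm_sq_eq_of_L2, Finset.sum_comm]
  simp only [PiLp.norm_sq_eq_of_L2]

theorem lintegral_exp_neg_retr (n m : ℕ) :
    ∫⁻ Y : Matrix (Fin n) (Fin m) 𝔽, ENNReal.ofReal (Real.exp (-retr (Yᴴ * Y)))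
        ∂(matVolume 𝔽 (Fin n) (Fin m))
      = ENNReal.ofReal (Real.pi ^ ((n : ℝ) * m * beta 𝔽 / 2)) := by
  have hmp := measurePreserving_matVolume_toLp 𝔽 (Fin n) (Fin m)
  simp only [← norm_sq_toLp_toLp]
  rw [hmp.lintegral_comp (f := fun z => ENNReal.ofReal (Real.exp (-‖z‖ ^ 2))) (by fun_prop)]
  have hint := GaussianFourier.integral_rexp_neg_mul_sq_norm
    (V := PiLp 2 fun _ : Fin m => Col 𝔽 (Fin n)) one_pos
  simp only [neg_one_mul, div_one, finrank_col_col, Fintype.card_fin] at hint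
  rw [← ofReal_integral_eq_lintegral_ofReal _ (.of_forall fun _ => (Real.exp_pos _).le), hint, beta]
  · push_cast
    ring_nf
  -- A nonintegrable function would have integral `0`, while the Gaussian value is positive.
  · refine Integrable.of_integral_ne_zero ?_
    rw [hint]
    exact (Real.rpow_pos_of_pos Real.pi_pos _).ne'

theorem exists_lintegral_retr {n m : ℕ} (hn : 0 < n) (hm : 0 < m) :
    ∃ K : ℝ≥0∞, ∀ {f : ℝ → ℝ≥0∞}, Measurable f →
      ∫⁻ Y : Matrix (Fin n) (Fin m) 𝔽, f (retr (Yᴴ * Y)) ∂(matVolume 𝔽 (Fin n) (Fin m))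
        = K * ∫⁻ s in Ioi (0 : ℝ), ENNReal.ofReal (s ^ ((n : ℝ) * m * beta 𝔽 / 2 - 1)) * f s := by
  obtain ⟨K, hK⟩ := exists_lintegral_norm_sq
    (Nat.mul_pos hm (Nat.mul_pos hn (finrank_pos' 𝔽)))
  refine ⟨K, fun {f} hf => ?_⟩
  have hmp := measurePreserving_matVolume_toLp 𝔽 (Fin n) (Fin m)
  have hr : Module.finrank ℝ (PiLp 2 fun _ : Fin m => Col 𝔽 (Fin n))
      = m * (n * Module.finrank ℝ 𝔽) := by simpa using finrank_col_col 𝔽 (Fin n) (Fin m)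
  simp only [← norm_sq_toLp_toLp]
  rw [hmp.lintegral_comp (f := fun z => f (‖z‖ ^ 2)) (by fun_prop), hK hr hf, beta]
  push_cast
  congr! 7
  ring

theorem exists_lintegral_conjTranspose_mul_self {n m : ℕ} (hm1 : 1 ≤ m) (hm : AssocOrSmall 𝔽 m)
    (hn : m ≤ n) :
    ∃ k : ℝ≥0∞, ∀ {f : Matrix (Fin m) (Fin m) 𝔽 → ℝ≥0∞}, Measurable f →
      ∫⁻ Y : Matrix (Fin n) (Fin m) 𝔽, f (Yᴴ * Y) ∂(matVolume 𝔽 (Fin n) (Fin m))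
        = k * ∫⁻ A in posDefCone 𝔽 m, ENNReal.ofReal (hdet A ^ (beta 𝔽 * ((n : ℝ) - m + 1) / 2 - 1))
          * f A ∂(hermVolume 𝔽 m) := by
  obtain ⟨m, rfl⟩ : ∃ m', m = m' + 1 := ⟨m - 1, by omega⟩
  obtain ⟨k, hk⟩ := exists_gramFormula 𝔽 (Fin n) hm hn
  refine ⟨k, fun {f} hf => ?_⟩
  have hexp : beta 𝔽 * ((n : ℝ) - ((m + 1 : ℕ) : ℝ) + 1) / 2 - 1
      = beta 𝔽 * ((n : ℝ) - m) / 2 - 1 := by push_cast; ring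
  rw [hexp]
  have h := hk ⊤ (by rw [finrank_top, finrank_col, Fintype.card_fin]) (fun _ _ _ _ => trivial) f hf
  rw [← h]
  let e : (⊤ : Submodule ℝ (Col 𝔽 (Fin n))) ≃ₗᵢ[ℝ] Col 𝔽 (Fin n) :=
    LinearIsometryEquiv.ofTop _ _ rfl
  have hmp : MeasurePreserving (fun (x : Fin (m + 1) → (⊤ : Submodule ℝ (Col 𝔽 (Fin n)))) j =>
      (x j : Col 𝔽 (Fin n))) (Measure.pi fun _ => volume) (Measure.pi fun _ => volume) :=
    measurePreserving_pi _ _ fun _ => e.measurePreserving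
  have hfg : Measurable fun x : Fin (m + 1) → Col 𝔽 (Fin n) => f (gram x) :=
    hf.comp measurable_gram
  rw [hmp.lintegral_comp hfg,
    ← (measurePreserving_matVolume_columns 𝔽 (Fin n) (Fin (m + 1))).lintegral_comp hfg]
  rfl

theorem multiGamma_eq_toReal {m : ℕ} (hm : AssocOrSmall 𝔽 m) (a : ℝ) :
    multiGamma 𝔽 m a = (∫⁻ A in posDefCone 𝔽 m,
      ENNReal.ofReal (hdet A ^ (a - ((m : ℝ) - 1) * beta 𝔽 / 2 - 1))
        * ENNReal.ofReal (Real.exp (-retr A)) ∂(hermVolume 𝔽 m)).toReal := by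
  rw [multiGamma, integral_eq_lintegral_of_nonneg_ae]
  · congr 1
    refine lintegral_congr fun A => ?_
    rw [ENNReal.ofReal_mul (Real.exp_pos _).le, mul_comm]
  · filter_upwards [ae_restrict_mem (measurableSet_posDefCone hm)] with A hA
    exact mul_nonneg (Real.exp_pos _).le (Real.rpow_nonneg (hdet_pos hm hA).le _)
  · exact ((Real.measurable_exp.comp measurable_retr.neg).mul
      (measurable_hdet.pow_const _)).aestronglyMeasurable

/-- In size one the cone is the positive half line, and the bordered coordinates reduce to `r`. -/
theorem multiGamma_one_eq_toReal (a : ℝ) :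
    multiGamma 𝔽 1 a = (∫⁻ s in Ioi (0 : ℝ),
      ENNReal.ofReal (s ^ (a - 1)) * ENNReal.ofReal (Real.exp (-s))).toReal := by
  have hm : AssocOrSmall 𝔽 (0 + 1) := Or.inr (by norm_num)
  have hf : Measurable fun A : Matrix (Fin (0 + 1)) (Fin (0 + 1)) 𝔽 =>
      ENNReal.ofReal (Real.exp (-retr A)) :=
    (Real.measurable_exp.comp measurable_retr.neg).ennreal_ofReal
  have hexp : a - (((0 + 1 : ℕ) : ℝ) - 1) * beta 𝔽 / 2 - 1 = a - 1 := by push_cast; ring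
  rw [multiGamma_eq_toReal 𝔽 hm, setLIntegral_posDefCone_succ hm _ hf, hexp]
  congr 1
  refine setLIntegral_congr_fun measurableSet_Ioi fun s _ => ?_
  rw [lintegral_posDefCone_zero]
  intro v W
  rw [retr_bordered]
  simp [retr, re]

theorem map_retr_matVolume {n m : ℕ} (hn : 0 < n) (hm : 0 < m) :
    0 < multiGamma 𝔽 1 ((n : ℝ) * m * beta 𝔽 / 2) ∧
    (matVolume 𝔽 (Fin n) (Fin m)).map (fun Y => retr (Yᴴ * Y))
      = ((volume : Measure ℝ).restrict (Ioi 0)).withDensity fun v => ENNReal.ofReal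
        (Real.pi ^ ((n : ℝ) * m * beta 𝔽 / 2) / multiGamma 𝔽 1 ((n : ℝ) * m * beta 𝔽 / 2)
          * v ^ ((n : ℝ) * m * beta 𝔽 / 2 - 1)) := by
  obtain ⟨K, hK⟩ := exists_lintegral_retr 𝔽 hn hm
  have hπ : 0 < Real.pi ^ ((n : ℝ) * m * beta 𝔽 / 2) := Real.rpow_pos_of_pos Real.pi_pos _
  -- This test function turns the two sides into the Gaussian and the Gamma integral, fixing `K`.
  have h1 := hK (f := fun s => ENNReal.ofReal (Real.exp (-s))) (by fun_prop)
  rw [lintegral_exp_neg_retr] at h1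
  obtain ⟨hG, hKe⟩ := ENNReal.eq_ofReal_div_toReal hπ h1.symm
  rw [← multiGamma_one_eq_toReal 𝔽] at hG hKe
  refine ⟨hG, Measure.ext_of_lintegral _ fun f hf => ?_⟩
  have hT : Measurable fun Y : Matrix (Fin n) (Fin m) 𝔽 => retr (Yᴴ * Y) :=
    measurable_retr.comp measurable_conjTranspose_mul_self
  rw [lintegral_map hf hT, hK hf, hKe,
    lintegral_withDensity_eq_lintegral_mul _ (by fun_prop) hf, ← lintegral_const_mul _ (by fun_prop)]
  refine lintegral_congr fun v => ?_
  rw [Pi.mul_apply, ENNReal.ofReal_mul (by positivity)]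
  exact (mul_assoc _ _ _).symm

/-- The Gram formula on the whole column space, with its constant fixed by the test function exp(-tr
A). -/
theorem map_conjTranspose_mul_self_matVolume {n m : ℕ} (hm1 : 1 ≤ m) (hm : AssocOrSmall 𝔽 m)
    (hn : m ≤ n) :
    0 < multiGamma 𝔽 m (beta 𝔽 * n / 2) ∧
    (matVolume 𝔽 (Fin n) (Fin m)).map (fun Y => Yᴴ * Y)
      = ((hermVolume 𝔽 m).restrict (posDefCone 𝔽 m)).withDensity fun A => ENNReal.ofReal
        (Real.pi ^ (beta 𝔽 * n * m / 2) / multiGamma 𝔽 m (beta 𝔽 * n / 2)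
          * hdet A ^ (beta 𝔽 * ((n : ℝ) - m + 1) / 2 - 1)) := by
  obtain ⟨K, hK⟩ := exists_lintegral_conjTranspose_mul_self 𝔽 hm1 hm hn
  have hπ : 0 < Real.pi ^ ((n : ℝ) * m * beta 𝔽 / 2) := Real.rpow_pos_of_pos Real.pi_pos _
  have hexpm : Measurable fun A : Matrix (Fin m) (Fin m) 𝔽 =>
      ENNReal.ofReal (Real.exp (-retr A)) :=
    (Real.measurable_exp.comp measurable_retr.neg).ennreal_ofReal
  have h1 := hK hexpm
  rw [lintegral_exp_neg_retr] at h1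
  obtain ⟨hG, hKe⟩ := ENNReal.eq_ofReal_div_toReal hπ h1.symm
  have hexp : beta 𝔽 * ((n : ℝ) - m + 1) / 2 - 1
      = beta 𝔽 * n / 2 - ((m : ℝ) - 1) * beta 𝔽 / 2 - 1 := by ring
  rw [hexp, ← multiGamma_eq_toReal 𝔽 hm] at hG hKe
  refine ⟨hG, Measure.ext_of_lintegral _ fun f hf => ?_⟩
  have hd : Measurable fun A : Matrix (Fin m) (Fin m) 𝔽 => ENNReal.ofReal
      (hdet A ^ (beta 𝔽 * ((n : ℝ) - m + 1) / 2 - 1)) := (measurable_hdet.pow_const _).ennreal_ofReal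
  have hdf : Measurable fun A : Matrix (Fin m) (Fin m) 𝔽 => ENNReal.ofReal
      (hdet A ^ (beta 𝔽 * ((n : ℝ) - m + 1) / 2 - 1)) * f A := hd.mul hf
  have hd' : Measurable fun A : Matrix (Fin m) (Fin m) 𝔽 => ENNReal.ofReal
      (Real.pi ^ (beta 𝔽 * n * m / 2) / multiGamma 𝔽 m (beta 𝔽 * n / 2)
        * hdet A ^ (beta 𝔽 * ((n : ℝ) - m + 1) / 2 - 1)) :=
    ((measurable_hdet.pow_const _).const_mul _).ennreal_ofReal
  rw [lintegral_map hf measurable_conjTranspose_mul_self, hK hf, hKe,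
    lintegral_withDensity_eq_lintegral_mul _ hd' hf, ← lintegral_const_mul _ hdf,
    show (n : ℝ) * m * beta 𝔽 / 2 = beta 𝔽 * n * m / 2 by ring]
  refine lintegral_congr fun v => ?_
  rw [Pi.mul_apply, ENNReal.ofReal_mul (by positivity)]
  exact (mul_assoc _ _ _).symm

end MatVolume

/-! ### From images of Lebesgue measure to joint densities -/

section Blocks

variable {k m : ℕ} {n : Fin (k + 1) → ℕ}

theorem retr_eq_sum_block (X : Matrix (Σ i, Fin (n i)) (Fin m) 𝔽) :
    retr (Xᴴ * X) = retr ((block X 0)ᴴ * block X 0)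
      + retr (∑ i : Fin k, (block X i.succ)ᴴ * block X i.succ) := by
  simp only [retr_sum, retr_conjTranspose_mul_self, Fintype.sum_sigma, Fin.sum_univ_succ]
  rfl

theorem measurePreserving_block :
    MeasurePreserving (fun X : Matrix (Σ i, Fin (n i)) (Fin m) 𝔽 =>
        (block X 0, fun i : Fin k => block X i.succ))
      (matVolume 𝔽 (Σ i, Fin (n i)) (Fin m))
      ((matVolume 𝔽 (Fin (n 0)) (Fin m)).prod
        (Measure.pi fun i : Fin k => matVolume 𝔽 (Fin (n i.succ)) (Fin m))) :=
  have := FiniteDimensional.proper_real 𝔽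
  (measurePreserving_piFinSuccAbove (fun i : Fin (k + 1) => matVolume 𝔽 (Fin (n i)) (Fin m)) 0).comp
    (measurePreserving_sigmaUncurry (κ := fun i : Fin (k + 1) => Fin (n i))
      (Measure.pi fun _ : Fin m => (volume : Measure 𝔽))).symm

/-- The density factors through the block map `S`, so it passes to the image measure, which is that
of the first block times Lebesgue measure on the others. -/
theorem hasDensity_of_map_block {Ω V : Type*} [MeasurableSpace Ω] [MeasurableSpace V]
    {P : Measure Ω} {X : Ω → Matrix (Σ i, Fin (n i)) (Fin m) 𝔽} {h : ℝ → ℝ}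
    (hX : IsSphericalElliptical P X h) {T : Matrix (Fin (n 0)) (Fin m) 𝔽 → V} (hT : Measurable T)
    {ν : Measure V} [SFinite ν] {ρ g : V → ℝ} (hρ : Measurable ρ) (hg : Measurable g)
    (hmap : (matVolume 𝔽 (Fin (n 0)) (Fin m)).map T = ν.withDensity fun v => ENNReal.ofReal (ρ v))
    (hgT : ∀ Y, retr (Yᴴ * Y) = g (T Y)) (hnn : ∀ᵐ v ∂ν, 0 ≤ ρ v ∧ 0 ≤ g v) :
    HasDensity P (fun ω => (T (block (X ω) 0), fun i : Fin k => block (X ω) i.succ))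
      (ν.prod (Measure.pi fun i : Fin k => matVolume 𝔽 (Fin (n i.succ)) (Fin m)))
      (fun p => ρ p.1 * h (beta 𝔽 * (g p.1 + retr (∑ i, (p.2 i)ᴴ * p.2 i)))) := by
  set π := Measure.pi fun i : Fin k => matVolume 𝔽 (Fin (n i.succ)) (Fin m) with hπ
  let S : Matrix (Σ i, Fin (n i)) (Fin m) 𝔽 →
      V × (∀ i : Fin k, Matrix (Fin (n i.succ)) (Fin m) 𝔽) :=
    fun X => (T (block X 0), fun i => block X i.succ)
  let w : V × (∀ i : Fin k, Matrix (Fin (n i.succ)) (Fin m) 𝔽) → ℝ := fun p =>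
    h (beta 𝔽 * (g p.1 + retr (∑ i, (p.2 i)ᴴ * p.2 i)))
  have hblk := measurePreserving_block (𝔽 := 𝔽) (m := m) (n := n)
  have hTid : Measurable (Prod.map T id : _ × (∀ i : Fin k, Matrix (Fin (n i.succ)) (Fin m) 𝔽) → _) :=
    hT.prodMap measurable_id
  have hS : Measurable S := hTid.comp hblk.measurable
  have hw : Measurable w := by
    refine hX.measurable_gen.comp (Measurable.const_mul ((hg.comp measurable_fst).add ?_) _)
    simp only [retr_sum]
    exact Finset.measurable_fun_sum _ fun i _ => (measurable_retr.comp
      measurable_conjTranspose_mul_self).comp ((measurable_pi_apply i).comp measurable_snd)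
  have hρ' : Measurable fun p : V × (∀ i : Fin k, Matrix (Fin (n i.succ)) (Fin m) 𝔽) => ρ p.1 :=
    hρ.comp measurable_fst
  have hae : ∀ᵐ p ∂(ν.prod π), 0 ≤ ρ p.1 ∧ 0 ≤ g p.1 :=
    Measure.quasiMeasurePreserving_fst.ae hnn
  have hmapS : (matVolume 𝔽 (Σ i, Fin (n i)) (Fin m)).map S
      = (ν.prod π).withDensity fun p => ENNReal.ofReal (ρ p.1) := by
    have : S = Prod.map T id ∘ fun X => (block X 0, fun i : Fin k => block X i.succ) := rfl
    rw [this, ← Measure.map_map hTid hblk.measurable, hblk.map_eq]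
    have hsf : SFinite ((matVolume 𝔽 (Fin (n 0)) (Fin m)).map T) := inferInstance
    rw [← Measure.map_prod_map _ _ hT measurable_id, Measure.map_id, hmap,
      prod_withDensity_left hρ.ennreal_ofReal]
  have hgen : ∀ Y : Matrix (Σ i, Fin (n i)) (Fin m) 𝔽, h (beta 𝔽 * retr (Yᴴ * Y)) = w (S Y) :=
    fun Y => by rw [retr_eq_sum_block, hgT]
  refine ⟨hS.comp_aemeasurable hX.hasDensity.aemeasurable, (hρ'.mul hw).aemeasurable, ?_, ?_⟩
  · filter_upwards [hae] with p hp
    refine mul_nonneg hp.1 (hX.gen_nonneg _ (mul_nonneg (beta_pos 𝔽).le (add_nonneg hp.2 ?_)))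
    simp only [retr_sum, retr_conjTranspose_mul_self]
    positivity
  · have hX' := hX.hasDensity.map_eq
    simp only [hgen] at hX'
    change P.map (S ∘ X) = _
    rw [← AEMeasurable.map_map_of_aemeasurable hS.aemeasurable hX.hasDensity.aemeasurable, hX',
      map_withDensity_comp _ hS hw.ennreal_ofReal, hmapS,
      ← withDensity_mul _ hρ'.ennreal_ofReal hw.ennreal_ofReal]
    refine withDensity_congr_ae ?_
    -- `ENNReal.ofReal` truncates at zero, so splitting the product needs `0 ≤ ρ`, known almost
    -- everywhere.
    filter_upwards [hae] with p hp
    rw [Pi.mul_apply, ENNReal.ofReal_mul hp.1]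

end Blocks

end NormedDivisionAlg

end

/-! ### The two joint densities -/

open NormedDivisionAlg in
theorem mainTheorem1 {𝔽 : Type*} [NormedAddCommGroup 𝔽] [InnerProductSpace ℝ 𝔽]
    [FiniteDimensional ℝ 𝔽] [Mul 𝔽] [One 𝔽] [Star 𝔽] [NormedDivisionAlg 𝔽]
    [MeasurableSpace 𝔽] [BorelSpace 𝔽]
    {Ω : Type*} [MeasurableSpace Ω] (P : Measure Ω) [IsProbabilityMeasure P]
    (k m : ℕ) (hm : 1 ≤ m) (n : Fin (k + 1) → ℕ) (hn : ∀ i, m ≤ n i)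
    (X : Ω → Matrix (Σ i, Fin (n i)) (Fin m) 𝔽) (h : ℝ → ℝ)
    (hX : IsSphericalElliptical P X h) :
    HasDensity P
      (fun ω => (retr ((block (X ω) 0)ᴴ * block (X ω) 0), fun i : Fin k => block (X ω) i.succ))
      (((volume : Measure ℝ).restrict (Set.Ioi 0)).prod
        (Measure.pi fun i : Fin k => matVolume 𝔽 (Fin (n i.succ)) (Fin m)))
      (fun p =>
        Real.pi ^ ((n 0 : ℝ) * m * beta 𝔽 / 2) / multiGamma 𝔽 1 ((n 0 : ℝ) * m * beta 𝔽 / 2)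
          * h (beta 𝔽 * (p.1 + retr (∑ i, (p.2 i)ᴴ * p.2 i)))
          * p.1 ^ ((n 0 : ℝ) * m * beta 𝔽 / 2 - 1)) ∧
    ((∀ a b c : 𝔽, a * b * c = a * (b * c)) ∨ m ≤ 2 →
      HasDensity P
        (fun ω => ((block (X ω) 0)ᴴ * block (X ω) 0, fun i : Fin k => block (X ω) i.succ))
        (((hermVolume 𝔽 m).restrict (posDefCone 𝔽 m)).prod
          (Measure.pi fun i : Fin k => matVolume 𝔽 (Fin (n i.succ)) (Fin m)))
        (fun p =>
          Real.pi ^ (beta 𝔽 * n 0 * m / 2)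
            * hdet p.1 ^ (beta 𝔽 * ((n 0 : ℝ) - m + 1) / 2 - 1)
            / multiGamma 𝔽 m (beta 𝔽 * n 0 / 2)
            * h (beta 𝔽 * retr (p.1 + ∑ i, (p.2 i)ᴴ * p.2 i)))) := by
  constructor
  · obtain ⟨hG, hmap⟩ := map_retr_matVolume 𝔽 (hm.trans (hn 0)) hm
    have hd := hasDensity_of_map_block hX
      (measurable_retr.comp measurable_conjTranspose_mul_self) (by fun_prop) measurable_id hmap
      (fun _ => rfl) <| by
        filter_upwards [ae_restrict_mem measurableSet_Ioi] with v hv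
        have hv' : 0 < v := hv
        exact ⟨by positivity, hv'.le⟩
    convert hd using 1
    · rfl
    · funext p
      simp only [id_eq]
      ring
  · intro hm2
    obtain ⟨hG, hmap⟩ := map_conjTranspose_mul_self_matVolume 𝔽 hm hm2 (hn 0)
    have hd := hasDensity_of_map_block hX measurable_conjTranspose_mul_self
      ((measurable_hdet.pow_const _).const_mul _) measurable_retr hmap (fun _ => rfl) <| by
        filter_upwards [ae_restrict_mem (measurableSet_posDefCone hm2)] with A hA
        have := hdet_pos hm2 hA
        exact ⟨by positivity, retr_nonneg hA⟩
    convert hd using 2 with p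
    rw [retr_add]
    ring
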